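/- \textbf{Theorem 1 (Outer Bound).} Let $\mathcal X,\mathcal Y,\mathcal U,\mathcal V$ be finite sets and let $(X_i,Y_i,U_i,V_i)$, $i=1,2,\dots$, be i.i.d. with law $Q$ on $\mathcal X\times\mathcal Y\times\mathcal U\times\mathcal V$. A code of block length $n$ with index sets $\mathcal M_0,\mathcal M_1,\mathcal M_2$ (finite, nonempty) consists of an encoder $e:\mathcal X^n\times\mathcal Y^n\to\mathcal M_0\times\mathcal M_1\times\mathcal M_2$ and two decoders $d_x:\mathcal M_0\times\mathcal M_1\times\mathcal U^n\to\mathcal X^n$ and $d_y:\mathcal M_0\times\mathcal M_2\times\mathcal V^n\to\mathcal Y^n$. With $(M_0,M_1,M_2)=e(X^n,Y^n)$, $\widehat X^n=d_x(M_0,M_1,U^n)$ and $\widehat Y^n=d_y(M_0,M_2,V^n)$, let $P_e=\max\{\Pr[\widehat X^n\neq X^n],\Pr[\widehat Y^n\neq Y^n]\}$. A triple $(R_0,R_1,R_2)$ of real numbers is achievable if for every $\epsilon>0$ and all sufficiently large $n$ there is a code of block length $n$ with $P_e\le\epsilon$ and $\frac1n\log_2|\mathcal M_i|\le R_i+\epsilon$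 for $i=0,1,2$. If $(R_0,R_1,R_2)$ is achievable, then there exist a finite set $\mathcal W$ with $|\mathcal W|\le|\mathcal X||\mathcal Y|+3$ and a probability function $p$ on $\mathcal W\times\mathcal X\times\mathcal Y\times\mathcal U\times\mathcal V$ with $\sum_{w}p(w,x,y,u,v)=Q(x,y,u,v)$ and $p(w,x,y,u,v)=p(w|x,y)\,p(x,y,u,v)$ (that is, $W-(X,Y)-(U,V)$ is a Markov chain) such that, with all information quantities computed in bits under $p$, \begin{align*} R_0&\ge\max\{I(X,Y;W|U),\,I(X,Y;W|V)\},\\ R_0+R_1&\ge\max\{I(X,Y;W|U),\,I(X,Y;W|V)\}+H(X|W,U),\\ R_0+R_2&\ge\max\{I(X,Y;W|U),\,I(X,Y;W|V)\}+H(Y|W,V). \end{align*} -/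

import Mathlib

namespace GrayWyner

/-! ### Information measures of a finite probability space

`p : Ω → ℝ` is a probability function on a finite set `Ω`, random variables are functions on `Ω`,
and all logarithms are to base `2`. -/

open Classical in
/-- The law of the random variable `f`: `law p f a = Prob[f = a]`. -/
noncomputable def law {Ω A : Type*} [Fintype Ω] (p : Ω → ℝ) (f : Ω → A) (a : A) : ℝ :=
  ∑ ω, if f ω = a then p ω else 0

/-- Conditional entropy `H(f | g) = - ∑ p(a, b) log₂ p(a | b)`.  A pair `(a, b)`
of probability zero contributes `0`, because of the factor `p(a, b)`. -/
noncomputable def condEntropy {Ω A B : Type*} [Fintype Ω] [Fintype A] [Fintype B]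
    (p : Ω → ℝ) (f : Ω → A) (g : Ω → B) : ℝ :=
  - ∑ a, ∑ b, law p (fun ω => (f ω, g ω)) (a, b) *
      Real.logb 2 (law p (fun ω => (f ω, g ω)) (a, b) / law p g b)

/-- Conditional mutual information `I(f ; h | g) = H(f | g) - H(f | h, g)`. -/
noncomputable def condMutualInfo {Ω A B C : Type*} [Fintype Ω] [Fintype A] [Fintype B] [Fintype C]
    (p : Ω → ℝ) (f : Ω → A) (h : Ω → B) (g : Ω → C) : ℝ :=
  condEntropy p f g - condEntropy p f (fun ω => (h ω, g ω))

/-! ### Codes and achievable rates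

A source letter is a quadruple `(x, y, u, v)`; a block of length `n` is a function on `Fin n`. -/

/-- A code of block length `n` with index sets of sizes `m₀`, `m₁`, `m₂` on the three channels. -/
structure Code (𝒳 𝒴 𝒰 𝒱 : Type*) (n m₀ m₁ m₂ : ℕ) where
  /-- the encoder, which sees both sources but no side information -/
  enc : (Fin n → 𝒳) × (Fin n → 𝒴) → Fin m₀ × Fin m₁ × Fin m₂
  /-- the decoder at the `x`-receiver -/
  decX : Fin m₀ × Fin m₁ × (Fin n → 𝒰) → (Fin n → 𝒳)
  /-- the decoder at the `y`-receiver -/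
  decY : Fin m₀ × Fin m₂ × (Fin n → 𝒱) → (Fin n → 𝒴)

section Code

variable {𝒳 𝒴 𝒰 𝒱 : Type*}

/-- The block `Xⁿ` of a block of source letters. -/
def xBlock {n : ℕ} (s : Fin n → 𝒳 × 𝒴 × 𝒰 × 𝒱) : Fin n → 𝒳 := fun i => (s i).1

/-- The block `Yⁿ` of a block of source letters. -/
def yBlock {n : ℕ} (s : Fin n → 𝒳 × 𝒴 × 𝒰 × 𝒱) : Fin n → 𝒴 := fun i => (s i).2.1

/-- The block `Uⁿ` of a block of source letters. -/
def uBlock {n : ℕ} (s : Fin n → 𝒳 × 𝒴 × 𝒰 × 𝒱) : Fin n → 𝒰 := fun i => (s i).2.2.1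

/-- The block `Vⁿ` of a block of source letters. -/
def vBlock {n : ℕ} (s : Fin n → 𝒳 × 𝒴 × 𝒰 × 𝒱) : Fin n → 𝒱 := fun i => (s i).2.2.2

/-- The reconstruction of `Xⁿ` at the `x`-receiver, from the indices on channels 0 and 1
and from `Uⁿ`. -/
def Code.xHat {n m₀ m₁ m₂ : ℕ} (c : Code 𝒳 𝒴 𝒰 𝒱 n m₀ m₁ m₂)
    (s : Fin n → 𝒳 × 𝒴 × 𝒰 × 𝒱) : Fin n → 𝒳 :=
  c.decX ((c.enc (xBlock s, yBlock s)).1, (c.enc (xBlock s, yBlock s)).2.1, uBlock s)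

/-- The reconstruction of `Yⁿ` at the `y`-receiver, from the indices on channels 0 and 2
and from `Vⁿ`. -/
def Code.yHat {n m₀ m₁ m₂ : ℕ} (c : Code 𝒳 𝒴 𝒰 𝒱 n m₀ m₁ m₂)
    (s : Fin n → 𝒳 × 𝒴 × 𝒰 × 𝒱) : Fin n → 𝒴 :=
  c.decY ((c.enc (xBlock s, yBlock s)).1, (c.enc (xBlock s, yBlock s)).2.2, vBlock s)

variable [Fintype 𝒳] [Fintype 𝒴] [Fintype 𝒰] [Fintype 𝒱]

/-- The probability that `n` independent letters with law `Q` form a block in `E`. -/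
noncomputable def blockProb (Q : 𝒳 × 𝒴 × 𝒰 × 𝒱 → ℝ) (n : ℕ)
    (E : (Fin n → 𝒳 × 𝒴 × 𝒰 × 𝒱) → Prop) : ℝ :=
  open Classical in
  ∑ s : Fin n → 𝒳 × 𝒴 × 𝒰 × 𝒱, if E s then ∏ i, Q (s i) else 0

/-- The larger of the two error probabilities. -/
noncomputable def Code.errorProb {n m₀ m₁ m₂ : ℕ} (c : Code 𝒳 𝒴 𝒰 𝒱 n m₀ m₁ m₂)
    (Q : 𝒳 × 𝒴 × 𝒰 × 𝒱 → ℝ) : ℝ :=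
  max (blockProb Q n fun s => c.xHat s ≠ xBlock s) (blockProb Q n fun s => c.yHat s ≠ yBlock s)

/-- `(R₀, R₁, R₂)` is achievable for the memoryless source with law `Q`.
The index sets are nonempty as soon as `𝒳` and `𝒴` are, because the encoder maps into them. -/
def Achievable (Q : 𝒳 × 𝒴 × 𝒰 × 𝒱 → ℝ) (R₀ R₁ R₂ : ℝ) : Prop :=
  ∀ ε : ℝ, 0 < ε → ∃ n₀ : ℕ, ∀ n : ℕ, n₀ ≤ n →
    ∃ (m₀ m₁ m₂ : ℕ) (c : Code 𝒳 𝒴 𝒰 𝒱 n m₀ m₁ m₂),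
      c.errorProb Q ≤ ε ∧
      1 / (n : ℝ) * Real.logb 2 (m₀ : ℝ) ≤ R₀ + ε ∧
      1 / (n : ℝ) * Real.logb 2 (m₁ : ℝ) ≤ R₁ + ε ∧
      1 / (n : ℝ) * Real.logb 2 (m₂ : ℝ) ≤ R₂ + ε

end Code

/-! ### The outer bound -/

section Outer

variable {𝒲 𝒳 𝒴 𝒰 𝒱 : Type*}

/-- The random variable `W` on `𝒲 × 𝒳 × 𝒴 × 𝒰 × 𝒱`. -/
def rvW (ω : 𝒲 × 𝒳 × 𝒴 × 𝒰 × 𝒱) : 𝒲 := ω.1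

/-- The random variable `X` on `𝒲 × 𝒳 × 𝒴 × 𝒰 × 𝒱`. -/
def rvX (ω : 𝒲 × 𝒳 × 𝒴 × 𝒰 × 𝒱) : 𝒳 := ω.2.1

/-- The random variable `Y` on `𝒲 × 𝒳 × 𝒴 × 𝒰 × 𝒱`. -/
def rvY (ω : 𝒲 × 𝒳 × 𝒴 × 𝒰 × 𝒱) : 𝒴 := ω.2.2.1

/-- The random variable `U` on `𝒲 × 𝒳 × 𝒴 × 𝒰 × 𝒱`. -/
def rvU (ω : 𝒲 × 𝒳 × 𝒴 × 𝒰 × 𝒱) : 𝒰 := ω.2.2.2.1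

/-- The random variable `V` on `𝒲 × 𝒳 × 𝒴 × 𝒰 × 𝒱`. -/
def rvV (ω : 𝒲 × 𝒳 × 𝒴 × 𝒰 × 𝒱) : 𝒱 := ω.2.2.2.2

variable [Fintype 𝒲] [Fintype 𝒳] [Fintype 𝒴] [Fintype 𝒰] [Fintype 𝒱]

/-- The probability functions on `𝒲 × 𝒳 × 𝒴 × 𝒰 × 𝒱` whose `(X, Y, U, V)`-marginal is `Q` and
for which `W – (X, Y) – (U, V)` is a Markov chain, that is,
`p(w, x, y, u, v) = p(w | x, y) p(x, y, u, v)`, written without division. -/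
def auxiliaryLaws (𝒲 : Type*) [Fintype 𝒲] (Q : 𝒳 × 𝒴 × 𝒰 × 𝒱 → ℝ) :
    Set (𝒲 × 𝒳 × 𝒴 × 𝒰 × 𝒱 → ℝ) :=
  {p | p ∈ stdSimplex ℝ (𝒲 × 𝒳 × 𝒴 × 𝒰 × 𝒱) ∧
    (∀ x y u v, ∑ w, p (w, x, y, u, v) = Q (x, y, u, v)) ∧
    ∀ w x y u v,
      p (w, x, y, u, v) * (∑ w', ∑ u', ∑ v', p (w', x, y, u', v')) =
        (∑ u', ∑ v', p (w, x, y, u', v')) * ∑ w', p (w', x, y, u, v)}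

/-- `max {I(X, Y; W | U), I(X, Y; W | V)}`. -/
noncomputable def commonInfo (p : 𝒲 × 𝒳 × 𝒴 × 𝒰 × 𝒱 → ℝ) : ℝ :=
  max (condMutualInfo p (fun ω => (rvX ω, rvY ω)) rvW rvU)
    (condMutualInfo p (fun ω => (rvX ω, rvY ω)) rvW rvV)

/-- The rate triples that satisfy the three inequalities of the outer bound for `p`. -/
def outerRegion (p : 𝒲 × 𝒳 × 𝒴 × 𝒰 × 𝒱 → ℝ) : Set (ℝ × ℝ × ℝ) :=
  {R | commonInfo p ≤ R.1 ∧
    commonInfo p + condEntropy p rvX (fun ω => (rvW ω, rvU ω)) ≤ R.1 + R.2.1 ∧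
    commonInfo p + condEntropy p rvY (fun ω => (rvW ω, rvV ω)) ≤ R.1 + R.2.2}

end Outer

end GrayWyner

namespace GrayWyner

/-! ### Entropy calculus -/

section Entropy

variable {Ω A B C D : Type*} [Fintype Ω]

/-! For a code of block length n put W_i = (M₀, U_{i+1}^n, V^{i-1}). It involves the source at time
i only through (X_i, Y_i), so W_i – (X_i, Y_i) – (U_i, V_i) is Markov (`Code.aux_congr`).

The common rate is bounded by log|M₀| ≥ H(M₀|Uⁿ) = nH(XY|U) − H(XⁿYⁿ|Uⁿ,M₀). The last entropy is at
most ∑ H(X_iY_i|W_i,U_i): expand it forwards in time and insert V^{i-1}, which is conditionally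
independent of the current letter given the rest of the condition. With U and V exchanged, expand
backwards and insert U_{i+1}^n (`cent_block_le_sum_past`, `cent_block_le_sum_future`).

For a sum rate, Fano bounds log|M₁| below by H(Xⁿ|Uⁿ,M₀) up to a small error, but comparing this
with ∑ H(X_i|W_i,U_i) directly gives an inequality in the wrong direction. Instead it is written as
H(XⁿYⁿUⁿ) − H(Yⁿ|Xⁿ,Uⁿ,M₀) − H(Uⁿ,M₀), where the middle term is single-letterised as above. When the
common rate is bounded through V, the difference H(Vⁿ,M₀) − H(Uⁿ,M₀) single-letterises exactly by
Csiszár's identity (`sum_ent_auxVar_sub`), and the Markov property reconciles the remaining terms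
(`sum_rate_bound`).

A uniform time T turns the averages into one auxiliary W = (T, W_T). A linear programming reduction
shrinks its alphabet to |𝒳||𝒴| + 3 letters, whatever n is (`exists_mem_channelLaws_fin`). All codes
thus yield points of one compact set, on which the continuous function `violation` attains its
minimum. Codes with vanishing ε make that minimum nonpositive. -/

/-- Entropy in nats, as the expected surprisal; it depends on `f` only through its level sets. -/
noncomputable def ent (p : Ω → ℝ) (f : Ω → A) : ℝ :=
  -∑ ω, p ω * Real.log (law p f (f ω))

/-- Conditional entropy in nats. -/
noncomputable def cent (p : Ω → ℝ) (f : Ω → A) (g : Ω → B) : ℝ :=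
  ent p (fun ω => (f ω, g ω)) - ent p g

theorem law_nonneg {p : Ω → ℝ} (hp : ∀ ω, 0 ≤ p ω) (f : Ω → A) (a : A) : 0 ≤ law p f a := by
  classical
  unfold law
  exact Finset.sum_nonneg fun ω _ => by split_ifs <;> simp [hp]

theorem le_law {p : Ω → ℝ} (hp : ∀ ω, 0 ≤ p ω) (f : Ω → A) (ω : Ω) : p ω ≤ law p f (f ω) := by
  classical
  unfold law
  have := Finset.single_le_sum (f := fun ω' => if f ω' = f ω then p ω' else 0)
    (fun ω' _ => by split_ifs <;> simp [hp]) (Finset.mem_univ ω)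
  simpa using this

theorem law_pos {p : Ω → ℝ} (hp : ∀ ω, 0 ≤ p ω) (f : Ω → A) {ω : Ω} (h : p ω ≠ 0) :
    0 < law p f (f ω) :=
  lt_of_lt_of_le (lt_of_le_of_ne (hp ω) h.symm) (le_law hp f ω)

theorem law_mono {p : Ω → ℝ} (hp : ∀ ω, 0 ≤ p ω) {f : Ω → A} {g : Ω → B} {a : A} {b : B}
    (h : ∀ ω, f ω = a → g ω = b) : law p f a ≤ law p g b := by
  classical
  unfold law
  refine Finset.sum_le_sum fun ω _ => ?_
  by_cases h1 : f ω = a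
  · simp [h1, h ω h1]
  · rw [if_neg h1]; split_ifs <;> simp [hp]

theorem law_congr {p : Ω → ℝ} {f : Ω → A} {g : Ω → B} {a : A} {b : B}
    (h : ∀ ω, p ω ≠ 0 → (f ω = a ↔ g ω = b)) : law p f a = law p g b := by
  classical
  unfold law
  refine Finset.sum_congr rfl fun ω _ => ?_
  by_cases h0 : p ω = 0
  · simp [h0]
  · simp only [h ω h0]

theorem ent_congr_support {p : Ω → ℝ} {f : Ω → A} {g : Ω → B}
    (h : ∀ ω ω', p ω ≠ 0 → p ω' ≠ 0 → (f ω = f ω' ↔ g ω = g ω')) : ent p f = ent p g := by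
  unfold ent
  congr 1
  refine Finset.sum_congr rfl fun ω _ => ?_
  by_cases h0 : p ω = 0
  · simp [h0]
  · rw [law_congr (fun ω' h' => h ω' ω h' h0)]

theorem ent_congr (p : Ω → ℝ) {f : Ω → A} {g : Ω → B}
    (h : ∀ ω ω', f ω = f ω' ↔ g ω = g ω') : ent p f = ent p g :=
  ent_congr_support fun ω ω' _ _ => h ω ω'

theorem sum_law_mul [Fintype A] (p : Ω → ℝ) (f : Ω → A) (F : A → ℝ) :
    ∑ a, law p f a * F a = ∑ ω, p ω * F (f ω) := by
  classical
  simp only [law, Finset.sum_mul]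
  rw [Finset.sum_comm]
  refine Finset.sum_congr rfl fun ω _ => ?_
  simp [ite_mul]

theorem sum_law [Fintype A] (p : Ω → ℝ) (f : Ω → A) : ∑ a, law p f a = ∑ ω, p ω := by
  simpa using sum_law_mul p f fun _ => 1

theorem ent_eq_sum_negMulLog [Fintype A] (p : Ω → ℝ) (f : Ω → A) :
    ent p f = ∑ a, Real.negMulLog (law p f a) := by
  unfold ent
  rw [← sum_law_mul p f fun a => Real.log (law p f a), ← Finset.sum_neg_distrib]
  simp [Real.negMulLog]

/-- Pushing a probability function forward does not change entropies. -/
theorem ent_law {Ω' : Type*} [Fintype Ω'] (p : Ω → ℝ) (F : Ω → Ω') (g : Ω' → A) :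
    ent (law p F) g = ent p fun ω => g (F ω) := by
  classical
  have h : ∀ a, law (law p F) g a = law p (fun ω => g (F ω)) a := fun a => by
    have := sum_law_mul p F fun x => if g x = a then (1 : ℝ) else 0
    simpa [law] using this
  unfold ent
  rw [sum_law_mul p F fun x => Real.log (law (law p F) g (g x))]
  simp only [h]

theorem cent_law {Ω' : Type*} [Fintype Ω'] (p : Ω → ℝ) (F : Ω → Ω') (f : Ω' → A) (g : Ω' → B) :
    cent (law p F) f g = cent p (fun ω => f (F ω)) fun ω => g (F ω) := by
  unfold cent
  rw [ent_law, ent_law]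

theorem condEntropy_eq_cent [Fintype A] [Fintype B] {p : Ω → ℝ} (hp : ∀ ω, 0 ≤ p ω)
    (f : Ω → A) (g : Ω → B) : condEntropy p f g = cent p f g / Real.log 2 := by
  unfold condEntropy cent ent
  rw [← Fintype.sum_prod_type' (f := fun a b => law p (fun ω => (f ω, g ω)) (a, b) *
      Real.logb 2 (law p (fun ω => (f ω, g ω)) (a, b) / law p g b)),
    sum_law_mul p (fun ω => (f ω, g ω)) fun x =>
      Real.logb 2 (law p (fun ω => (f ω, g ω)) (x.1, x.2) / law p g x.2)]
  rw [neg_sub_neg, ← Finset.sum_sub_distrib, Finset.sum_div, ← Finset.sum_neg_distrib]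
  refine Finset.sum_congr rfl fun ω _ => ?_
  by_cases h0 : p ω = 0
  · simp [h0]
  · rw [Real.logb, Real.log_div (law_pos hp (fun ω => (f ω, g ω)) h0).ne' (law_pos hp g h0).ne']
    ring

/-- Gibbs' inequality for conditional entropy. -/
theorem cent_le_cross [Finite A] [Finite B] {p : Ω → ℝ} (hp : p ∈ stdSimplex ℝ Ω)
    (f : Ω → A) (g : Ω → B) (q : A → B → ℝ) (hq0 : ∀ a b, 0 ≤ q a b)
    (hqpos : ∀ ω, p ω ≠ 0 → 0 < q (f ω) (g ω))
    (hq : ∀ s : Finset A, ∀ b, ∑ a ∈ s, q a b ≤ 1) :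
    cent p f g ≤ -∑ ω, p ω * Real.log (q (f ω) (g ω)) := by
  classical
  have := Fintype.ofFinite A
  have := Fintype.ofFinite B
  have h0 := hp.1
  set L := law p fun ω => (f ω, g ω) with hL
  -- The likelihood ratio p(b)q(a|b)/p(a,b) has mean at most 1; `log x ≤ x - 1` is then applied to
  -- it pointwise.
  have key : ∑ ω, p ω * (law p g (g ω) * q (f ω) (g ω) / L (f ω, g ω)) ≤ 1 := by
    rw [← sum_law_mul p (fun ω => (f ω, g ω)) fun x => law p g x.2 * q x.1 x.2 / L (x.1, x.2),
      Fintype.sum_prod_type, Finset.sum_comm]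
    calc ∑ b, ∑ a, L (a, b) * (law p g b * q a b / L (a, b))
        ≤ ∑ b, ∑ a, law p g b * q a b := by
          refine Finset.sum_le_sum fun b _ => Finset.sum_le_sum fun a _ => ?_
          by_cases h : L (a, b) = 0
          · rw [h]; simpa using mul_nonneg (law_nonneg h0 g b) (hq0 a b)
          · rw [mul_div_cancel₀ _ h]
      _ ≤ ∑ b, law p g b := by
          refine Finset.sum_le_sum fun b _ => ?_
          rw [← Finset.mul_sum]
          exact mul_le_of_le_one_right (law_nonneg h0 g b) (hq _ b)
      _ = 1 := by rw [sum_law, hp.2]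
  have hterm : ∀ ω, p ω * Real.log (law p g (g ω)) - p ω * Real.log (L (f ω, g ω))
      + p ω * Real.log (q (f ω) (g ω)) ≤
      p ω * (law p g (g ω) * q (f ω) (g ω) / L (f ω, g ω)) - p ω := fun ω => by
    by_cases h : p ω = 0
    · simp [h]
    · have h1 := law_pos h0 g h
      have h2 : 0 < L (f ω, g ω) := law_pos h0 (fun ω => (f ω, g ω)) h
      have h3 := hqpos ω h
      have h4 := Real.log_le_sub_one_of_pos (div_pos (mul_pos h1 h3) h2)
      rw [Real.log_div (mul_pos h1 h3).ne' h2.ne', Real.log_mul h1.ne' h3.ne'] at h4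
      nlinarith [mul_le_mul_of_nonneg_left h4 (h0 ω)]
  have := Finset.sum_le_sum fun ω (_ : ω ∈ Finset.univ) => hterm ω
  rw [Finset.sum_add_distrib, Finset.sum_sub_distrib, Finset.sum_sub_distrib, hp.2] at this
  unfold cent ent
  linarith

/-- Conditioning reduces entropy. -/
theorem cent_le_cent [Finite A] [Finite B] {p : Ω → ℝ} (hp : p ∈ stdSimplex ℝ Ω)
    (f : Ω → A) {g : Ω → B} {h : Ω → C} (hgh : ∀ ω ω', g ω = g ω' → h ω = h ω') :
    cent p f g ≤ cent p f h := by
  classical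
  have := Fintype.ofFinite A
  obtain ⟨ω₀⟩ : Nonempty Ω := by
    by_contra hne
    rw [not_nonempty_iff] at hne
    simpa using hp.2
  have hk : ∃ k : B → C, ∀ ω, k (g ω) = h ω :=
    ⟨fun b => if hb : ∃ ω, g ω = b then h hb.choose else h ω₀, fun ω => by
      have hb : ∃ ω', g ω' = g ω := ⟨ω, rfl⟩
      refine (dif_pos hb).trans ?_
      exact hgh _ _ hb.choose_spec⟩
  obtain ⟨k, hk⟩ := hk
  have h0 := hp.1
  have hsum : ∀ c, ∑ a, law p (fun ω => (f ω, h ω)) (a, c) = law p h c := fun c => by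
    simp only [law]
    rw [Finset.sum_comm]
    refine Finset.sum_congr rfl fun ω _ => ?_
    by_cases hc : h ω = c <;> simp [hc]
  -- Gibbs with the test channel P(f = a | h = k b), where `h = k ∘ g`; its cross entropy is exactly
  -- H(f|h).
  refine (cent_le_cross hp f g
    (fun a b => law p (fun ω => (f ω, h ω)) (a, k b) / law p h (k b))
    (fun a b => div_nonneg (law_nonneg h0 _ _) (law_nonneg h0 _ _)) (fun ω hω => ?_)
    (fun s b => ?_)).trans (le_of_eq ?_)
  · rw [hk]
    exact div_pos (law_pos h0 (fun ω => (f ω, h ω)) hω) (law_pos h0 h hω)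
  · refine (Finset.sum_le_univ_sum_of_nonneg fun a => div_nonneg (law_nonneg h0 _ _)
      (law_nonneg h0 _ _)).trans ?_
    rw [← Finset.sum_div, hsum]
    exact div_self_le_one _
  · unfold cent ent
    rw [neg_sub_neg, ← Finset.sum_sub_distrib, ← Finset.sum_neg_distrib]
    refine Finset.sum_congr rfl fun ω _ => ?_
    by_cases hω : p ω = 0
    · simp [hω]
    · rw [hk, Real.log_div (law_pos h0 (fun ω => (f ω, h ω)) hω).ne' (law_pos h0 h hω).ne']
      ring

theorem ent_mono {p : Ω → ℝ} (hp : ∀ ω, 0 ≤ p ω) {f : Ω → A} {g : Ω → B}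
    (h : ∀ ω ω', f ω = f ω' → g ω = g ω') : ent p g ≤ ent p f := by
  unfold ent
  refine neg_le_neg (Finset.sum_le_sum fun ω _ => ?_)
  by_cases h0 : p ω = 0
  · simp [h0]
  · exact mul_le_mul_of_nonneg_left
      (Real.log_le_log (law_pos hp f h0) (law_mono hp fun ω' => h ω' ω)) (hp ω)

theorem cent_nonneg {p : Ω → ℝ} (hp : ∀ ω, 0 ≤ p ω) (f : Ω → A) (g : Ω → B) :
    0 ≤ cent p f g :=
  sub_nonneg.2 (ent_mono hp fun _ _ h => (Prod.ext_iff.1 h).2)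

theorem cent_le_log_card [Fintype A] [Finite B] {p : Ω → ℝ} (hp : p ∈ stdSimplex ℝ Ω)
    (f : Ω → A) (g : Ω → B) : cent p f g ≤ Real.log (Fintype.card A) := by
  refine (cent_le_cross hp f g (fun _ _ => (Fintype.card A : ℝ)⁻¹) (fun _ _ => by positivity)
    (fun ω _ => ?_) (fun s _ => ?_)).trans (le_of_eq ?_)
  · have : Nonempty A := ⟨f ω⟩
    have := Fintype.card_pos (α := A)
    positivity
  · rw [Finset.sum_const, nsmul_eq_mul]
    exact (mul_le_mul_of_nonneg_right (by exact_mod_cast Finset.card_le_univ s)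
      (by positivity)).trans (mul_inv_le_one)
  · rw [← Finset.sum_mul, hp.2, Real.log_inv]
    ring

/-- Fano's inequality. -/
theorem cent_le_of_estimate [Fintype A] [Finite B] {p : Ω → ℝ} (hp : p ∈ stdSimplex ℝ Ω)
    (f : Ω → A) (g : Ω → B) (d : B → A) (E : Ω → Prop) [DecidablePred E]
    (hE : ∀ ω, ¬E ω → d (g ω) = f ω) :
    cent p f g ≤ Real.log 2 + (∑ ω, if E ω then p ω else 0) * Real.log (Fintype.card A) := by
  classical
  set N : ℝ := (Fintype.card A : ℝ) with hN
  have hpos : ∀ ω : Ω, 1 ≤ N := fun ω => by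
    have : Nonempty A := ⟨f ω⟩
    rw [hN]
    exact_mod_cast Fintype.card_pos (α := A)
  have hN0 : 0 ≤ N := by positivity
  -- The test channel mixes the estimate and the uniform law equally: surprisal is at most log 2
  -- when the estimate is right and at most log 2 + log N always.
  refine (cent_le_cross hp f g (fun a b => (if a = d b then 1 / 2 else 0) + 1 / 2 * N⁻¹)
    (fun a b => by positivity) (fun ω _ => ?_) (fun s b => ?_)).trans ?_
  · have := hpos ω
    positivity
  · have h1 : ∑ a ∈ s, (if a = d b then (1 / 2 : ℝ) else 0) ≤ 1 / 2 := by
      rw [Finset.sum_ite_eq']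
      split_ifs <;> norm_num
    have h2 : ∑ a ∈ s, (1 / 2 * N⁻¹) ≤ 1 / 2 := by
      rw [Finset.sum_const, nsmul_eq_mul]
      have : (s.card : ℝ) * N⁻¹ ≤ 1 :=
        (mul_le_mul_of_nonneg_right (by rw [hN]; exact_mod_cast Finset.card_le_univ s)
          (by positivity)).trans (mul_inv_le_one)
      linarith
    rw [Finset.sum_add_distrib]
    linarith
  · have h1 : Real.log 2 = ∑ ω, p ω * Real.log 2 := by rw [← Finset.sum_mul, hp.2, one_mul]
    rw [h1, Finset.sum_mul, ← Finset.sum_add_distrib, ← Finset.sum_neg_distrib]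
    refine Finset.sum_le_sum fun ω _ => ?_
    have hω := hpos ω
    have hNpos : 0 < N := by linarith
    rw [← mul_neg]
    by_cases hEω : E ω
    · rw [if_pos hEω, ← mul_add]
      refine mul_le_mul_of_nonneg_left ?_ (hp.1 ω)
      have : -(Real.log 2 + Real.log N) = Real.log (1 / 2 * N⁻¹) := by
        rw [Real.log_mul (by norm_num) (by positivity), Real.log_inv, one_div, Real.log_inv]
        ring
      rw [neg_le, this]
      refine Real.log_le_log (by positivity) ?_
      split_ifs <;> norm_num
    · rw [if_neg hEω, zero_mul, add_zero, if_pos (hE ω hEω).symm]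
      refine mul_le_mul_of_nonneg_left ?_ (hp.1 ω)
      rw [neg_le, ← Real.log_inv]
      refine Real.log_le_log (by norm_num) ?_
      have : 0 ≤ N⁻¹ := by positivity
      linarith

/-- The defect c log c ∑ p does not involve `f`, so it cancels in conditional entropies. -/
theorem ent_smul (c : ℝ) (p : Ω → ℝ) (f : Ω → A) (hp : ∀ ω, 0 ≤ p ω) :
    ent (fun ω => c * p ω) f = c * ent p f - c * Real.log c * ∑ ω, p ω := by
  classical
  have hl : ∀ a, law (fun ω => c * p ω) f a = c * law p f a := fun a => by
    simp [law, Finset.mul_sum]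
  unfold ent
  rcases eq_or_ne c 0 with rfl | hc
  · simp
  rw [mul_neg, Finset.mul_sum, Finset.mul_sum, ← Finset.sum_neg_distrib, ← Finset.sum_neg_distrib,
    ← Finset.sum_sub_distrib]
  refine Finset.sum_congr rfl fun ω _ => ?_
  by_cases h : p ω = 0
  · simp [h]
  · rw [hl, Real.log_mul hc (law_pos hp f h).ne']
    ring

/-- Conditional entropy is homogeneous in the (unnormalised) law. -/
theorem cent_smul (c : ℝ) (p : Ω → ℝ) (f : Ω → A) (g : Ω → B) (hp : ∀ ω, 0 ≤ p ω) :
    cent (fun ω => c * p ω) f g = c * cent p f g := by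
  unfold cent
  rw [ent_smul _ _ _ hp, ent_smul _ _ _ hp]
  ring

/-- The slices are left unnormalised, so no separate term for the entropy of the index appears.
Together with homogeneity this makes conditional entropy given W a sum over the letters of W. -/
theorem ent_prod {I : Type*} [Fintype I] (p : I × Ω → ℝ) (f : I → Ω → A) :
    ent p (fun x => (x.1, f x.1 x.2)) = ∑ i, ent (fun ω => p (i, ω)) (f i) := by
  classical
  have hl : ∀ i a, law p (fun x => (x.1, f x.1 x.2)) (i, a) = law (fun ω => p (i, ω)) (f i) a := by
    intro i a
    simp only [law, Fintype.sum_prod_type, Prod.mk.injEq]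
    rw [Finset.sum_eq_single i]
    · simp
    · intro j _ hj
      simp [hj]
    · simp
  simp only [ent, Fintype.sum_prod_type, hl, Finset.sum_neg_distrib]

theorem cent_prod {I : Type*} [Fintype I] (p : I × Ω → ℝ) (f : I → Ω → A) (g : I → Ω → B) :
    cent p (fun x => f x.1 x.2) (fun x => (x.1, g x.1 x.2)) =
      ∑ i, cent (fun ω => p (i, ω)) (f i) (g i) := by
  unfold cent
  rw [Finset.sum_sub_distrib, ← ent_prod p g, ← ent_prod p fun i ω => (f i ω, g i ω)]
  congr 1
  exact ent_congr _ fun x y => by simp only [Prod.mk.injEq]; tauto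

end Entropy

/-! ### Memoryless sources -/

section Source

variable {ι S A B C M W : Type*}

/-- The law of a block of independent letters. -/
noncomputable def blockLaw {S : Type*} (ι : Type*) [Fintype ι] (Q : S → ℝ) (s : ι → S) : ℝ := ∏ i, Q (s i)

/-- The letters `φ (s j)` with `j ∈ J`. -/
def letters (φ : S → A) (J : Set ι) (s : ι → S) : J → A := fun j => φ (s j)

theorem letters_eq_iff {φ : S → A} {J : Set ι} {s t : ι → S} :
    letters φ J s = letters φ J t ↔ ∀ j ∈ J, φ (s j) = φ (t j) := by
  simp [letters, funext_iff]

theorem dependsOn_letters (φ : S → A) (J : Set ι) : DependsOn (letters φ J) J :=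
  fun _ _ h => letters_eq_iff.2 fun j hj => by rw [h j hj]

variable [Fintype ι] [Fintype S] [DecidableEq ι]

theorem sum_prod_eq_prod_sum (h : ι → S → ℝ) : ∑ s : ι → S, ∏ i, h i (s i) = ∏ i, ∑ x, h i x := by
  rw [Finset.prod_univ_sum, Fintype.piFinset_univ]

theorem blockLaw_mem {Q : S → ℝ} (hQ : Q ∈ stdSimplex ℝ S) :
    blockLaw ι Q ∈ stdSimplex ℝ (ι → S) :=
  ⟨fun _ => Finset.prod_nonneg fun _ _ => hQ.1 _, by
    simp [blockLaw, sum_prod_eq_prod_sum fun _ => Q, hQ.2]⟩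

theorem sum_blockLaw_mul {Q : S → ℝ} (hQ : Q ∈ stdSimplex ℝ S) (i : ι) (F : S → ℝ) :
    ∑ s, blockLaw ι Q s * F (s i) = ∑ x, Q x * F x := by
  have h1 : ∀ s : ι → S, blockLaw ι Q s * F (s i) =
      ∏ j, Q (s j) * (if j = i then F (s j) else 1) := fun s => by
    rw [Finset.prod_mul_distrib, Finset.prod_ite_eq' Finset.univ i]
    simp [blockLaw]
  simp only [h1]
  rw [sum_prod_eq_prod_sum fun j x => Q x * (if j = i then F x else 1), Finset.prod_eq_single i]
  · simp
  · intro j _ hj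
    simp [hj, hQ.2]
  · simp

theorem law_letter {Q : S → ℝ} (hQ : Q ∈ stdSimplex ℝ S) (i : ι) (φ : S → A) (a : A) :
    law (blockLaw ι Q) (fun s => φ (s i)) a = law Q φ a := by
  classical
  simpa [law] using sum_blockLaw_mul hQ i fun x => if φ x = a then (1 : ℝ) else 0

theorem law_eval {Q : S → ℝ} (hQ : Q ∈ stdSimplex ℝ S) (i : ι) (z : S) :
    law (blockLaw ι Q) (fun s => s i) z = Q z :=
  (law_letter hQ i id z).trans (by classical simp [law])

theorem ent_letter {Q : S → ℝ} (hQ : Q ∈ stdSimplex ℝ S) (i : ι) (φ : S → A) :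
    ent (blockLaw ι Q) (fun s => φ (s i)) = ent Q φ := by
  simp only [ent, law_letter hQ]
  rw [sum_blockLaw_mul hQ i fun x => Real.log (law Q φ (φ x))]

theorem ent_block {Q : S → ℝ} (hQ : Q ∈ stdSimplex ℝ S) (φ : S → A) :
    ent (blockLaw ι Q) (fun s i => φ (s i)) = Fintype.card ι * ent Q φ := by
  classical
  have h : ∀ a : ι → A, law (blockLaw ι Q) (fun s i => φ (s i)) a = ∏ i, law Q φ (a i) :=
    fun a => by
    simp only [law]
    rw [← sum_prod_eq_prod_sum fun i x => if φ x = a i then Q x else 0]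
    refine Finset.sum_congr rfl fun s _ => ?_
    by_cases hs : (fun i => φ (s i)) = a
    · subst hs
      simp [blockLaw]
    · rw [if_neg hs]
      obtain ⟨i, hi⟩ := Function.ne_iff.1 hs
      exact (Finset.prod_eq_zero (Finset.mem_univ i) (if_neg hi)).symm
  have h2 : ∀ s, blockLaw ι Q s * Real.log (law (blockLaw ι Q) (fun s i => φ (s i))
      fun i => φ (s i)) = ∑ i, blockLaw ι Q s * Real.log (law Q φ (φ (s i))) := fun s => by
    by_cases hs : blockLaw ι Q s = 0
    · simp [hs]
    · rw [h, Real.log_prod, Finset.mul_sum]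
      intro i _
      refine (law_pos hQ.1 φ fun h0 => hs ?_).ne'
      exact Finset.prod_eq_zero (Finset.mem_univ i) h0
  simp only [ent, h2]
  rw [Finset.sum_comm]
  simp [sum_blockLaw_mul hQ _ fun x => Real.log (law Q φ (φ x))]

/-- Functions of disjoint sets of letters are independent. -/
theorem law_prod_of_dependsOn (Q : S → ℝ) (J : Set ι) {f : (ι → S) → A} {g : (ι → S) → B}
    (hf : DependsOn f J) (hg : DependsOn g Jᶜ) (a : A) (b : B) :
    law (blockLaw ι Q) (fun s => (f s, g s)) (a, b) * ∑ s, blockLaw ι Q s =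
      law (blockLaw ι Q) f a * law (blockLaw ι Q) g b := by
  classical
  -- Two independent copies of the block exchange their coordinates outside `J`; this preserves the
  -- product weight and moves `g` from one copy to the other.
  have hinv : Function.Involutive fun x : (ι → S) × (ι → S) =>
      (J.piecewise x.1 x.2, J.piecewise x.2 x.1) := fun x => by
    ext i <;> by_cases hi : i ∈ J <;> simp [hi]
  simp only [law, Finset.sum_mul_sum]
  rw [← Fintype.sum_prod_type', ← Fintype.sum_prod_type']
  refine Fintype.sum_equiv hinv.toPerm _ _ fun x => ?_
  have h1 : f (J.piecewise x.1 x.2) = f x.1 := hf fun i hi => by simp [hi]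
  have h2 : g (J.piecewise x.2 x.1) = g x.1 := hg fun i hi => by
    simp [Set.notMem_of_mem_compl hi]
  have h3 : blockLaw ι Q (J.piecewise x.1 x.2) * blockLaw ι Q (J.piecewise x.2 x.1) =
      blockLaw ι Q x.1 * blockLaw ι Q x.2 := by
    simp only [blockLaw, ← Finset.prod_mul_distrib]
    refine Finset.prod_congr rfl fun i _ => ?_
    by_cases hi : i ∈ J <;> simp [hi, mul_comm]
  simp only [Function.Involutive.coe_toPerm, h1, h2, Prod.mk.injEq]
  by_cases ha : f x.1 = a <;> by_cases hb : g x.1 = b <;> simp [ha, hb, h3]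

theorem ent_prod_of_dependsOn {Q : S → ℝ} (hQ : Q ∈ stdSimplex ℝ S) (J : Set ι)
    {f : (ι → S) → A} {g : (ι → S) → B} (hf : DependsOn f J) (hg : DependsOn g Jᶜ) :
    ent (blockLaw ι Q) (fun s => (f s, g s)) = ent (blockLaw ι Q) f + ent (blockLaw ι Q) g := by
  have hP := blockLaw_mem (ι := ι) hQ
  simp only [ent]
  rw [← neg_add, ← Finset.sum_add_distrib]
  congr 1
  refine Finset.sum_congr rfl fun s _ => ?_
  by_cases hs : blockLaw ι Q s = 0
  · simp [hs]
  · have := law_prod_of_dependsOn Q J hf hg (f s) (g s)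
    rw [hP.2, mul_one] at this
    rw [this, Real.log_mul (law_pos hP.1 f hs).ne' (law_pos hP.1 g hs).ne', mul_add]

/-- Given the letters `χ` on `J`, the letters `ν` on `J` are independent of every variable that is
a function of the letters `χ` on `J` and of the source outside `J`. -/
theorem cent_letters_eq [Finite A] [Finite B] [Finite C] {Q : S → ℝ} (hQ : Q ∈ stdSimplex ℝ S)
    (J : Set ι) (ν : S → A) (χ : S → B) {g : (ι → S) → C}
    (h₁ : ∀ s t, g s = g t → ∀ j ∈ J, χ (s j) = χ (t j))
    (h₂ : ∀ s t, (∀ j ∈ J, χ (s j) = χ (t j)) → (∀ j ∉ J, s j = t j) → g s = g t) :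
    cent (blockLaw ι Q) (letters ν J) g = cent (blockLaw ι Q) (letters ν J) (letters χ J) := by
  have hP := blockLaw_mem (ι := ι) hQ
  apply le_antisymm
  · exact cent_le_cent hP _ fun s t h => letters_eq_iff.2 (h₁ s t h)
  -- Revealing all letters outside `J` does not change the entropy, by independence, and the
  -- enlarged condition determines `g`.
  · have e : cent (blockLaw ι Q) (letters ν J) (letters χ J) = cent (blockLaw ι Q) (letters ν J)
        fun s => (letters χ J s, letters (id : S → S) Jᶜ s) := by
      have i1 := ent_prod_of_dependsOn hQ J (f := fun s => (letters ν J s, letters χ J s))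
        (g := letters (id : S → S) Jᶜ) (fun s t h => Prod.ext (dependsOn_letters ν J h)
          (dependsOn_letters χ J h)) (dependsOn_letters _ _)
      have i2 := ent_prod_of_dependsOn hQ J (dependsOn_letters χ J)
        (dependsOn_letters (id : S → S) Jᶜ)
      have i3 : ent (blockLaw ι Q) (fun s => (letters ν J s, letters χ J s,
            letters (id : S → S) Jᶜ s)) = ent (blockLaw ι Q)
            (fun s => ((letters ν J s, letters χ J s), letters (id : S → S) Jᶜ s)) :=
        ent_congr _ fun s t => by simp only [Prod.mk.injEq]; tauto
      unfold cent
      rw [i3, i1, i2]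
      ring
    rw [e]
    refine cent_le_cent hP _ fun s t h => ?_
    simp only [Prod.mk.injEq, letters_eq_iff] at h
    exact h₂ s t h.1 h.2

/-- One step of the chain rule for `H(φⁿ | ψⁿ, m)`: the letters `ν` on `J` may be added to the
condition for free. -/
theorem ent_insert_le [Finite A] [Finite B] [Finite C] [Finite M] [Finite W] {Q : S → ℝ}
    (hQ : Q ∈ stdSimplex ℝ S) (J : Set ι) (i : ι)
    (φ : S → A) (ψ : S → B) (ν : S → C) {m : (ι → S) → M} {w : (ι → S) → W}
    (hm : ∀ s t, (∀ j, φ (s j) = φ (t j)) → (∀ j, ψ (s j) = ψ (t j)) → m s = m t)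
    (hw : ∀ s t, m s = m t → (∀ j ∈ J, ν (s j) = ν (t j)) →
      (∀ j, ψ (s j) = ψ (t j)) → w s = w t) :
    ent (blockLaw ι Q) (fun s => (letters φ (insert i J) s, (fun j => ψ (s j)), m s)) -
      ent (blockLaw ι Q) (fun s => (letters φ J s, (fun j => ψ (s j)), m s)) ≤
    cent (blockLaw ι Q) (fun s => φ (s i)) (fun s => (w s, ψ (s i))) := by
  set P := blockLaw ι Q with hPdef
  have hP : P ∈ stdSimplex ℝ (ι → S) := blockLaw_mem hQ
  set g : (ι → S) → (J → A) × (ι → B) × M :=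
    fun s => (letters φ J s, (fun j => ψ (s j)), m s) with hg
  have hgs : ∀ s t, g s = g t ↔ (∀ j ∈ J, φ (s j) = φ (t j)) ∧ (∀ j, ψ (s j) = ψ (t j)) ∧
      m s = m t := fun s t => by
    simp only [hg, Prod.mk.injEq, letters_eq_iff]
    simp only [funext_iff]
  -- `c1` and `c2` give H(ν_J|g) = H(ν_J|φ_i,g), i.e. I(ν_J;φ_i|g) = 0; by symmetry ν_J can join the
  -- condition of φ_i, and `c3` then shrinks that condition.
  have c1 : cent P (letters ν J) g = cent P (letters ν J) (letters (fun x => (φ x, ψ x)) J) := by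
    refine cent_letters_eq hQ J ν _ (fun s t h j hj => ?_) fun s t h h' => ?_
    · rw [hgs] at h
      exact Prod.ext (h.1 j hj) (h.2.1 j)
    · have hφ : ∀ j, φ (s j) = φ (t j) := fun j => by
        by_cases hj : j ∈ J
        · exact (Prod.ext_iff.1 (h j hj)).1
        · rw [h' j hj]
      have hψ : ∀ j, ψ (s j) = ψ (t j) := fun j => by
        by_cases hj : j ∈ J
        · exact (Prod.ext_iff.1 (h j hj)).2
        · rw [h' j hj]
      exact (hgs s t).2 ⟨fun j _ => hφ j, hψ, hm s t hφ hψ⟩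
  have c2 : cent P (letters ν J) (fun s => (φ (s i), g s)) =
      cent P (letters ν J) (letters (fun x => (φ x, ψ x)) J) := by
    refine cent_letters_eq hQ J ν _ (fun s t h j hj => ?_) fun s t h h' => ?_
    · rw [Prod.mk.injEq, hgs] at h
      exact Prod.ext (h.2.1 j hj) (h.2.2.1 j)
    · have hφ : ∀ j, φ (s j) = φ (t j) := fun j => by
        by_cases hj : j ∈ J
        · exact (Prod.ext_iff.1 (h j hj)).1
        · rw [h' j hj]
      have hψ : ∀ j, ψ (s j) = ψ (t j) := fun j => by
        by_cases hj : j ∈ J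
        · exact (Prod.ext_iff.1 (h j hj)).2
        · rw [h' j hj]
      exact Prod.ext (hφ i) ((hgs s t).2 ⟨fun j _ => hφ j, hψ, hm s t hφ hψ⟩)
  have c3 : cent P (fun s => φ (s i)) (fun s => (letters ν J s, g s)) ≤
      cent P (fun s => φ (s i)) (fun s => (w s, ψ (s i))) := by
    refine cent_le_cent hP _ fun s t h => ?_
    rw [Prod.mk.injEq, hgs, letters_eq_iff] at h
    exact Prod.ext (hw s t h.2.2.2 h.1 h.2.2.1) (h.2.2.1 i)
  have e1 : ent P (fun s => (φ (s i), letters ν J s, g s)) =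
      ent P (fun s => (letters ν J s, φ (s i), g s)) :=
    ent_congr _ fun s t => by simp only [Prod.mk.injEq]; tauto
  have e2 : ent P (fun s => (letters φ (insert i J) s, (fun j => ψ (s j)), m s)) =
      ent P (fun s => (φ (s i), g s)) :=
    ent_congr _ fun s t => by
      simp only [Prod.mk.injEq, hgs, letters_eq_iff, Set.forall_mem_insert]
      simp only [funext_iff]
      tauto
  rw [e2]
  refine le_trans (le_of_eq ?_) c3
  rw [← c2] at c1
  unfold cent at c1 ⊢
  rw [e1]
  linarith

end Source

/-! ### Single-letter bounds for conditional block entropies -/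

section Chain

variable {S A B C M W : Type*} [Fintype S] [Finite A] [Finite B] [Finite C] [Finite M] [Finite W]
  {n : ℕ}

/-- `H(φⁿ | ψⁿ, m) ≤ ∑ H(φᵢ | wᵢ, ψᵢ)` when `wᵢ` is a function of `m`, `ψⁿ` and the past of `ν`. -/
theorem cent_block_le_sum_past {Q : S → ℝ} (hQ : Q ∈ stdSimplex ℝ S) (φ : S → A) (ψ : S → B)
    (ν : S → C) {m : (Fin n → S) → M} {w : Fin n → (Fin n → S) → W}
    (hm : ∀ s t, (∀ j, φ (s j) = φ (t j)) → (∀ j, ψ (s j) = ψ (t j)) → m s = m t)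
    (hw : ∀ i s t, m s = m t → (∀ j < i, ν (s j) = ν (t j)) →
      (∀ j, ψ (s j) = ψ (t j)) → w i s = w i t) :
    cent (blockLaw (Fin n) Q) (fun s j => φ (s j)) (fun s => ((fun j => ψ (s j)), m s)) ≤
      ∑ i, cent (blockLaw (Fin n) Q) (fun s => φ (s i)) (fun s => (w i s, ψ (s i))) := by
  set P := blockLaw (Fin n) Q
  -- Telescopes from H(ψⁿ, m) at `k = 0` to H(φⁿ, ψⁿ, m) at `k = n`.
  set F : ℕ → ℝ := fun k => ent P
    (fun s => (letters φ {j : Fin n | (j : ℕ) < k} s, (fun j => ψ (s j)), m s)) with hF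
  have hstep : ∀ i : Fin n, F (i + 1) - F i ≤
      cent P (fun s => φ (s i)) (fun s => (w i s, ψ (s i))) := fun i => by
    have := ent_insert_le hQ {j : Fin n | (j : ℕ) < i} i φ ψ ν hm
      (w := w i) (fun s t h1 h2 h3 => hw i s t h1 (fun j hj => h2 j hj) h3)
    have hs : insert i {j : Fin n | (j : ℕ) < i} = {j : Fin n | (j : ℕ) < i + 1} := by
      ext j
      simp only [Set.mem_insert_iff, Set.mem_ofPred_eq, Fin.ext_iff]
      omega
    rw [hs] at this
    exact this
  refine le_trans (le_of_eq ?_) (Finset.sum_le_sum fun i _ => hstep i)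
  rw [Fin.sum_univ_eq_sum_range (fun k => F (k + 1) - F k), Finset.sum_range_sub]
  unfold cent
  congr 1
  · exact ent_congr _ fun s t => by
      simp only [Prod.mk.injEq, letters_eq_iff]
      simp [funext_iff]
  · exact ent_congr _ fun s t => by simp [letters_eq_iff]

/-- `H(φⁿ | ψⁿ, m) ≤ ∑ H(φᵢ | wᵢ, ψᵢ)` when `wᵢ` is a function of `m`, `ψⁿ` and the future
of `ν`. -/
theorem cent_block_le_sum_future {Q : S → ℝ} (hQ : Q ∈ stdSimplex ℝ S) (φ : S → A) (ψ : S → B)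
    (ν : S → C) {m : (Fin n → S) → M} {w : Fin n → (Fin n → S) → W}
    (hm : ∀ s t, (∀ j, φ (s j) = φ (t j)) → (∀ j, ψ (s j) = ψ (t j)) → m s = m t)
    (hw : ∀ i s t, m s = m t → (∀ j > i, ν (s j) = ν (t j)) →
      (∀ j, ψ (s j) = ψ (t j)) → w i s = w i t) :
    cent (blockLaw (Fin n) Q) (fun s j => φ (s j)) (fun s => ((fun j => ψ (s j)), m s)) ≤
      ∑ i, cent (blockLaw (Fin n) Q) (fun s => φ (s i)) (fun s => (w i s, ψ (s i))) := by
  set P := blockLaw (Fin n) Q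
  -- The same chain rule run backwards: position `i` is added to the positions after it, so F
  -- decreases in `k`.
  set F : ℕ → ℝ := fun k => ent P
    (fun s => (letters φ {j : Fin n | k ≤ (j : ℕ)} s, (fun j => ψ (s j)), m s)) with hF
  have hstep : ∀ i : Fin n, F i - F (i + 1) ≤
      cent P (fun s => φ (s i)) (fun s => (w i s, ψ (s i))) := fun i => by
    have := ent_insert_le hQ {j : Fin n | (i : ℕ) + 1 ≤ j} i φ ψ ν hm
      (w := w i) (fun s t h1 h2 h3 => hw i s t h1 (fun j hj => h2 j hj) h3)
    have hs : insert i {j : Fin n | (i : ℕ) + 1 ≤ j} = {j : Fin n | (i : ℕ) ≤ j} := by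
      ext j
      simp only [Set.mem_insert_iff, Set.mem_ofPred_eq, Fin.ext_iff]
      omega
    rw [hs] at this
    exact this
  refine le_trans (le_of_eq ?_) (Finset.sum_le_sum fun i _ => hstep i)
  rw [Fin.sum_univ_eq_sum_range (fun k => F k - F (k + 1)), Finset.sum_range_sub']
  unfold cent
  congr 1
  · exact ent_congr _ fun s t => by
      simp only [Prod.mk.injEq, letters_eq_iff]
      simp [funext_iff]
  · exact ent_congr _ fun s t => by simp [letters_eq_iff]

end Chain

/-! ### The converse for a code of a given block length -/

section Converse

variable {S A B C D E M W : Type*} {n : ℕ}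

/-- The auxiliary variable of the converse: the index on the common channel, the future of `α` and
the past of `β`. -/
def auxVar (α : S → A) (β : S → B) (m : (Fin n → S) → M) (i : Fin n) (s : Fin n → S) :
    M × (Fin n → Option A) × (Fin n → Option B) :=
  (m s, (fun j => if i < j then some (α (s j)) else none),
    fun j => if j < i then some (β (s j)) else none)

/-- Masking with `none` keeps the value type independent of `i`, as time sharing needs; this lemma
removes the mask. -/
theorem auxVar_eq_iff {α : S → A} {β : S → B} {m : (Fin n → S) → M} {i : Fin n}
    {s t : Fin n → S} : auxVar α β m i s = auxVar α β m i t ↔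
      m s = m t ∧ (∀ j > i, α (s j) = α (t j)) ∧ ∀ j < i, β (s j) = β (t j) := by
  simp only [auxVar, Prod.mk.injEq, funext_iff]
  refine and_congr_right fun _ => and_congr (forall_congr' fun j => ?_) (forall_congr' fun j => ?_)
  · by_cases h : i < j <;> simp [h]
  · by_cases h : j < i <;> simp [h]

variable [Fintype S]

/-- Given the letter `χ` at position `i`, the letter `ν` there is independent of every function of
that letter and of the other positions. -/
theorem ent_letter_cond [Finite A] [Finite D] [Finite W] {Q : S → ℝ} (hQ : Q ∈ stdSimplex ℝ S)
    (χ : S → D) (ν : S → A) (i : Fin n) {w : (Fin n → S) → W}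
    (hw : ∀ s t, χ (s i) = χ (t i) → (∀ j ≠ i, s j = t j) → w s = w t) :
    ent (blockLaw (Fin n) Q) (fun s => (χ (s i), w s, ν (s i))) =
      ent (blockLaw (Fin n) Q) (fun s => (χ (s i), w s)) + cent Q ν χ := by
  have h := cent_letters_eq hQ {i} ν χ (g := fun s => (χ (s i), w s))
    (fun s t h j hj => by rw [Set.mem_singleton_iff.1 hj]; exact (Prod.ext_iff.1 h).1)
    (fun s t h h' => Prod.ext (h i rfl) (hw s t (h i rfl) fun j hj => h' j hj))
  unfold cent at h ⊢
  rw [← ent_letter hQ i, ← ent_letter hQ i]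
  have e1 : ent (blockLaw (Fin n) Q) (fun s => (χ (s i), w s, ν (s i))) =
      ent (blockLaw (Fin n) Q) (fun s => (letters ν {i} s, χ (s i), w s)) :=
    ent_congr _ fun s t => by
      simp only [Prod.mk.injEq, letters_eq_iff, Set.mem_singleton_iff, forall_eq]
      tauto
  have e2 : ent (blockLaw (Fin n) Q) (fun s => (letters ν {i} s, letters χ {i} s)) =
      ent (blockLaw (Fin n) Q) (fun s => (ν (s i), χ (s i))) :=
    ent_congr _ fun s t => by
      simp only [Prod.mk.injEq, letters_eq_iff, Set.mem_singleton_iff, forall_eq]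
  have e3 : ent (blockLaw (Fin n) Q) (letters χ {i}) =
      ent (blockLaw (Fin n) Q) (fun s => χ (s i)) :=
    ent_congr _ fun s t => by
      simp only [letters_eq_iff, Set.mem_singleton_iff, forall_eq]
  rw [e1, ← e2, ← e3]
  linarith

/-- Since `m` is a function of χⁿ, H(m|αⁿ) = I(χⁿ;m|αⁿ) = nH(χ|α) − H(χⁿ|αⁿ,m). -/
theorem common_rate_bound {Q : S → ℝ} (hQ : Q ∈ stdSimplex ℝ S) (χ : S → D) (α : S → A)
    {m : (Fin n → S) → M} {w : Fin n → (Fin n → S) → W} {r₀ : ℝ}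
    (hm : ∀ s t, (∀ j, χ (s j) = χ (t j)) → m s = m t)
    (hχ : cent (blockLaw (Fin n) Q) (fun s j => χ (s j)) (fun s => ((fun j => α (s j)), m s)) ≤
      ∑ i, cent (blockLaw (Fin n) Q) (fun s => χ (s i)) (fun s => (w i s, α (s i))))
    (h₀ : cent (blockLaw (Fin n) Q) m (fun s j => α (s j)) ≤ r₀) :
    n * cent Q χ α - ∑ i, cent (blockLaw (Fin n) Q) (fun s => χ (s i))
      (fun s => (w i s, α (s i))) ≤ r₀ := by
  set P := blockLaw (Fin n) Q
  refine (sub_le_sub_left hχ _).trans (le_trans (le_of_eq ?_) h₀)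
  have b1 := ent_block (ι := Fin n) hQ fun z => (χ z, α z)
  have b2 := ent_block (ι := Fin n) hQ α
  rw [Fintype.card_fin] at b1 b2
  have e1 : ent P (fun s => ((fun j => χ (s j)), (fun j => α (s j)), m s)) =
      ent P (fun s i => (χ (s i), α (s i))) := ent_congr _ fun s t => by
    simp only [Prod.mk.injEq, funext_iff, forall_and]
    exact ⟨fun h => ⟨h.1, h.2.1⟩, fun h => ⟨h.1, h.2, hm s t h.1⟩⟩
  have e2 : ent P (fun s => (m s, fun j => α (s j))) = ent P (fun s => ((fun j => α (s j)), m s)) :=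
    ent_congr _ fun s t => by simp only [Prod.mk.injEq]; tauto
  unfold cent
  rw [e1, e2, b1, b2]
  ring

/-- Expand H(m|βⁿ) + H(φⁿ|αⁿ,m) into joint entropies, `χ` standing for the pair (φ, ψ). The only
loss comes from `hψ`; `hαβ` handles H(βⁿ,m) − H(αⁿ,m). Here α is the receiver's own side information
and β the one through which the common rate is bounded. -/
theorem sum_rate_bound [Finite A] [Finite B] [Finite C] [Finite D] [Finite E] [Finite W]
    {Q : S → ℝ} (hQ : Q ∈ stdSimplex ℝ S) (χ : S → D) (φ : S → A) (ψ : S → B) (α : S → C)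
    (β : S → E) (hχ : ∀ a b, χ a = χ b ↔ φ a = φ b ∧ ψ a = ψ b)
    {m : (Fin n → S) → M} {w : Fin n → (Fin n → S) → W} {r₀ r₁ : ℝ}
    (hm : ∀ s t, (∀ j, χ (s j) = χ (t j)) → m s = m t)
    (hw : ∀ i s t, χ (s i) = χ (t i) → (∀ j ≠ i, s j = t j) → w i s = w i t)
    (hψ : cent (blockLaw (Fin n) Q) (fun s j => ψ (s j))
        (fun s => ((fun j => (φ (s j), α (s j))), m s)) ≤
      ∑ i, cent (blockLaw (Fin n) Q) (fun s => ψ (s i)) (fun s => (w i s, (φ (s i), α (s i)))))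
    (hαβ : ∑ i, (ent (blockLaw (Fin n) Q) (fun s => (w i s, α (s i))) -
        ent (blockLaw (Fin n) Q) (fun s => (w i s, β (s i)))) =
      ent (blockLaw (Fin n) Q) (fun s => ((fun j => α (s j)), m s)) -
        ent (blockLaw (Fin n) Q) (fun s => ((fun j => β (s j)), m s)))
    (h₀ : cent (blockLaw (Fin n) Q) m (fun s j => β (s j)) ≤ r₀)
    (h₁ : cent (blockLaw (Fin n) Q) (fun s j => φ (s j))
      (fun s => ((fun j => α (s j)), m s)) ≤ r₁) :
    n * cent Q χ β - ∑ i, cent (blockLaw (Fin n) Q) (fun s => χ (s i))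
        (fun s => (w i s, β (s i))) +
      ∑ i, cent (blockLaw (Fin n) Q) (fun s => φ (s i)) (fun s => (w i s, α (s i))) ≤ r₀ + r₁ := by
  have b1 := ent_block (ι := Fin n) hQ fun z => (χ z, α z)
  have b2 := ent_block (ι := Fin n) hQ β
  rw [Fintype.card_fin] at b1 b2
  set P := blockLaw (Fin n) Q
  have e1 : ent P (fun s => ((fun j => ψ (s j)), (fun j => (φ (s j), α (s j))), m s)) =
      ent P (fun s i => (χ (s i), α (s i))) := ent_congr _ fun s t => by
    simp only [Prod.mk.injEq, funext_iff, hχ, forall_and]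
    refine ⟨fun h => ⟨⟨h.2.1.1, h.1⟩, h.2.1.2⟩, fun h => ⟨h.1.2, ⟨h.1.1, h.2⟩, hm s t fun j => ?_⟩⟩
    exact (hχ _ _).2 ⟨h.1.1 j, h.1.2 j⟩
  have e2 : ent P (fun s => (m s, fun j => β (s j))) = ent P (fun s => ((fun j => β (s j)), m s)) :=
    ent_congr _ fun s t => by simp only [Prod.mk.injEq]; tauto
  have e3 : ent P (fun s => ((fun j => (φ (s j), α (s j))), m s)) =
      ent P (fun s => ((fun j => φ (s j)), (fun j => α (s j)), m s)) := ent_congr _ fun s t => by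
    simp only [Prod.mk.injEq, funext_iff, forall_and]
    tauto
  have e4 : ∀ i, ent P (fun s => (ψ (s i), w i s, φ (s i), α (s i))) =
      ent P (fun s => (χ (s i), w i s, α (s i))) := fun i => ent_congr _ fun s t => by
    simp only [Prod.mk.injEq, hχ]
    tauto
  have e5 : ∀ i, ent P (fun s => (w i s, φ (s i), α (s i))) =
      ent P (fun s => (φ (s i), w i s, α (s i))) := fun i => ent_congr _ fun s t => by
    simp only [Prod.mk.injEq]
    tauto
  have e6 : ent Q (fun z => (χ z, β z)) = ent Q (fun z => (β z, χ z)) :=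
    ent_congr _ fun s t => by simp only [Prod.mk.injEq]; tauto
  have e7 : ent Q (fun z => (χ z, α z)) = ent Q (fun z => (α z, χ z)) :=
    ent_congr _ fun s t => by simp only [Prod.mk.injEq]; tauto
  -- The Markov property: given χ_i, the auxiliary variable does not affect the entropy of α_i or
  -- β_i, so one can be traded for the other at single-letter cost.
  have e8 : ∑ i, (ent P (fun s => (χ (s i), w i s, β (s i))) -
      ent P (fun s => (χ (s i), w i s, α (s i)))) = n * (cent Q β χ - cent Q α χ) := by
    simp only [P, ent_letter_cond hQ χ β _ (hw _), ent_letter_cond hQ χ α _ (hw _),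
      add_sub_add_left_eq_sub]
    simp [mul_sub]
  unfold cent at hψ h₀ h₁ e8 ⊢
  simp only [e1, e2, e3, e4, e5, b1, b2, e6, e7, Finset.sum_sub_distrib] at hψ hαβ h₀ h₁ e8 ⊢
  linarith

/-- Csiszár's sum identity. -/
theorem sum_ent_auxVar_sub (p : (Fin n → S) → ℝ) (α : S → A) (β : S → B) (m : (Fin n → S) → M) :
    ∑ i, (ent p (fun s => (auxVar α β m i s, α (s i))) -
        ent p (fun s => (auxVar α β m i s, β (s i)))) =
      ent p (fun s => ((fun j => α (s j)), m s)) -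
        ent p (fun s => ((fun j => β (s j)), m s)) := by
  -- A hybrid of the two blocks, with β before `k` and α from `k` on. Adjoining α_i to the auxiliary
  -- variable gives `G i`, adjoining β_i gives `G (i + 1)`, so the sum telescopes.
  set G : ℕ → ℝ := fun k => ent p (fun s => (m s, letters α {j : Fin n | k ≤ j} s,
    letters β {j : Fin n | (j : ℕ) < k} s)) with hG
  have h1 : ∀ i : Fin n, ent p (fun s => (auxVar α β m i s, α (s i))) = G i := fun i =>
    ent_congr _ fun s t => by
      simp only [Prod.mk.injEq, letters_eq_iff, auxVar_eq_iff, Set.mem_ofPred_eq, gt_iff_lt,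
        ← Fin.lt_def, ← Fin.le_def]
      constructor
      · rintro ⟨⟨h1, h2, h3⟩, h4⟩
        refine ⟨h1, fun j hj => ?_, h3⟩
        rcases hj.eq_or_lt with rfl | hj
        exacts [h4, h2 j hj]
      · exact fun ⟨h1, h2, h3⟩ => ⟨⟨h1, fun j hj => h2 j hj.le, h3⟩, h2 i le_rfl⟩
  have h2 : ∀ i : Fin n, ent p (fun s => (auxVar α β m i s, β (s i))) = G (i + 1) := fun i =>
    ent_congr _ fun s t => by
      simp only [Prod.mk.injEq, letters_eq_iff, auxVar_eq_iff, Set.mem_ofPred_eq, gt_iff_lt,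
        Nat.lt_succ_iff, Nat.succ_le_iff, ← Fin.lt_def, ← Fin.le_def]
      constructor
      · rintro ⟨⟨h1, h2, h3⟩, h4⟩
        refine ⟨h1, h2, fun j hj => ?_⟩
        rcases hj.eq_or_lt with rfl | hj
        exacts [h4, h3 j hj]
      · exact fun ⟨h1, h2, h3⟩ => ⟨⟨h1, h2, fun j hj => h3 j hj.le⟩, h3 i le_rfl⟩
  simp only [h1, h2]
  rw [Fin.sum_univ_eq_sum_range (fun k => G k - G (k + 1)), Finset.sum_range_sub']
  congr 1
  · exact ent_congr _ fun s t => by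
      simp only [Prod.mk.injEq, letters_eq_iff]
      simp [funext_iff, and_comm]
  · exact ent_congr _ fun s t => by
      simp only [Prod.mk.injEq, letters_eq_iff]
      simp [funext_iff, and_comm]

/-- `H(φⁿ | αⁿ, m) ≤ log |M'| + H(φⁿ | m', αⁿ, m)` for `m'` with values in `M'`. -/
theorem cent_le_log_card_add [Finite A] [Finite B] [Fintype M] {p : S → ℝ}
    (hp : p ∈ stdSimplex ℝ S) (f : S → A) (g : S → B) (m : S → M) :
    cent p f g ≤ Real.log (Fintype.card M) + cent p f (fun s => (m s, g s)) := by
  have h1 := cent_le_log_card hp m g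
  have h2 : ent p (fun s => (f s, g s)) ≤ ent p (fun s => (f s, m s, g s)) :=
    ent_mono hp.1 fun s t => by simp only [Prod.mk.injEq]; tauto
  unfold cent at *
  linarith

end Converse

/-! ### The rate bounds for a Gray–Wyner code -/

section CodeConverse

variable {𝒳 𝒴 𝒰 𝒱 : Type*} {n m₀ m₁ m₂ : ℕ}

/-- The auxiliary variable of a code at position `i`. -/
def Code.aux (c : Code 𝒳 𝒴 𝒰 𝒱 n m₀ m₁ m₂) : Fin n → (Fin n → 𝒳 × 𝒴 × 𝒰 × 𝒱) →
    Fin m₀ × (Fin n → Option 𝒰) × (Fin n → Option 𝒱) :=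
  auxVar (fun z => z.2.2.1) (fun z => z.2.2.2) fun s => (c.enc (xBlock s, yBlock s)).1

/-- The source of the Markov chain: the encoder sees no side information, and the strict future of U
and strict past of V omit position `i`. -/
theorem Code.aux_congr (c : Code 𝒳 𝒴 𝒰 𝒱 n m₀ m₁ m₂) (i : Fin n)
    (s t : Fin n → 𝒳 × 𝒴 × 𝒰 × 𝒱) (h : ((s i).1, (s i).2.1) = ((t i).1, (t i).2.1))
    (h' : ∀ j ≠ i, s j = t j) : c.aux i s = c.aux i t := by
  refine auxVar_eq_iff.2 ⟨?_, fun j hj => by rw [h' j hj.ne'], fun j hj => by rw [h' j hj.ne]⟩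
  have hxy : ∀ j, (s j).1 = (t j).1 ∧ (s j).2.1 = (t j).2.1 := fun j => by
    rcases eq_or_ne j i with rfl | hj
    · exact Prod.mk.injEq .. ▸ h
    · rw [h' j hj]; exact ⟨rfl, rfl⟩
  have hx : xBlock s = xBlock t := funext fun j => (hxy j).1
  have hy : yBlock s = yBlock t := funext fun j => (hxy j).2
  rw [hx, hy]

variable [Fintype 𝒳] [Fintype 𝒴] [Fintype 𝒰] [Fintype 𝒱]

/-- The bounds on the rates of a code in terms of its auxiliary variables. -/
theorem Code.converse (c : Code 𝒳 𝒴 𝒰 𝒱 n m₀ m₁ m₂) {Q : 𝒳 × 𝒴 × 𝒰 × 𝒱 → ℝ}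
    (hQ : Q ∈ stdSimplex ℝ (𝒳 × 𝒴 × 𝒰 × 𝒱)) {a hX hY : ℝ}
    (ha : a = max
      (n * cent Q (fun z => (z.1, z.2.1)) (fun z => z.2.2.1) -
        ∑ i, cent (blockLaw (Fin n) Q) (fun s => ((s i).1, (s i).2.1))
          (fun s => (c.aux i s, (s i).2.2.1)))
      (n * cent Q (fun z => (z.1, z.2.1)) (fun z => z.2.2.2) -
        ∑ i, cent (blockLaw (Fin n) Q) (fun s => ((s i).1, (s i).2.1))
          (fun s => (c.aux i s, (s i).2.2.2))))
    (hhX : hX = ∑ i, cent (blockLaw (Fin n) Q) (fun s => (s i).1)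
      (fun s => (c.aux i s, (s i).2.2.1)))
    (hhY : hY = ∑ i, cent (blockLaw (Fin n) Q) (fun s => (s i).2.1)
      (fun s => (c.aux i s, (s i).2.2.2))) :
    a ≤ Real.log m₀ ∧
    a + hX ≤ Real.log m₀ + (Real.log m₁ + (Real.log 2 +
      c.errorProb Q * (n * Real.log (Fintype.card 𝒳)))) ∧
    a + hY ≤ Real.log m₀ + (Real.log m₂ + (Real.log 2 +
      c.errorProb Q * (n * Real.log (Fintype.card 𝒴)))) := by
  classical
  set P := blockLaw (Fin n) Q with hPdef
  have hP : P ∈ stdSimplex ℝ (Fin n → 𝒳 × 𝒴 × 𝒰 × 𝒱) := blockLaw_mem hQ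
  set m : (Fin n → 𝒳 × 𝒴 × 𝒰 × 𝒱) → Fin m₀ := fun s => (c.enc (xBlock s, yBlock s)).1 with hmdef
  have hm' : ∀ s t, (∀ j, (s j).1 = (t j).1) → (∀ j, (s j).2.1 = (t j).2.1) → m s = m t :=
    fun s t h1 h2 => by
      have hx : xBlock s = xBlock t := funext h1
      have hy : yBlock s = yBlock t := funext h2
      simp only [hmdef, hx, hy]
  have hm : ∀ s t, (∀ j, ((s j).1, (s j).2.1) = ((t j).1, (t j).2.1)) → m s = m t :=
    fun s t h => hm' s t (fun j => (Prod.ext_iff.1 (h j)).1) fun j => (Prod.ext_iff.1 (h j)).2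
  have haux : ∀ i s t, c.aux i s = c.aux i t ↔ m s = m t ∧
      (∀ j > i, (s j).2.2.1 = (t j).2.2.1) ∧ ∀ j < i, (s j).2.2.2 = (t j).2.2.2 :=
    fun i s t => auxVar_eq_iff
  have h1U := cent_block_le_sum_past hQ (fun z => (z.1, z.2.1)) (fun z => z.2.2.1)
    (fun z => z.2.2.2) (fun s t h _ => hm s t h) (w := c.aux)
    fun i s t h1 h2 h3 => (haux i s t).2 ⟨h1, fun j _ => h3 j, h2⟩
  have h1V := cent_block_le_sum_future hQ (fun z => (z.1, z.2.1)) (fun z => z.2.2.2)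
    (fun z => z.2.2.1) (fun s t h _ => hm s t h) (w := c.aux)
    fun i s t h1 h2 h3 => (haux i s t).2 ⟨h1, h2, fun j _ => h3 j⟩
  have h3U := cent_block_le_sum_past hQ (fun z => z.2.1) (fun z => (z.1, z.2.2.1))
    (fun z => z.2.2.2) (m := m) (w := c.aux)
    (fun s t h h' => hm' s t (fun j => (Prod.ext_iff.1 (h' j)).1) h)
    fun i s t h1 h2 h3 => (haux i s t).2 ⟨h1, fun j _ => (Prod.ext_iff.1 (h3 j)).2, h2⟩
  have h3V := cent_block_le_sum_future hQ (fun z => z.1) (fun z => (z.2.1, z.2.2.2))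
    (fun z => z.2.2.1) (m := m) (w := c.aux)
    (fun s t h h' => hm' s t h fun j => (Prod.ext_iff.1 (h' j)).1)
    fun i s t h1 h2 h3 => (haux i s t).2 ⟨h1, h2, fun j _ => (Prod.ext_iff.1 (h3 j)).2⟩
  have hcs : ∑ i, (ent P (fun s => (c.aux i s, (s i).2.2.1)) -
      ent P (fun s => (c.aux i s, (s i).2.2.2))) =
      ent P (fun s => ((fun j => (s j).2.2.1), m s)) -
        ent P (fun s => ((fun j => (s j).2.2.2), m s)) := sum_ent_auxVar_sub P _ _ m
  have hcs' : ∑ i, (ent P (fun s => (c.aux i s, (s i).2.2.2)) -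
      ent P (fun s => (c.aux i s, (s i).2.2.1))) =
      ent P (fun s => ((fun j => (s j).2.2.2), m s)) -
        ent P (fun s => ((fun j => (s j).2.2.1), m s)) := by
    rw [← neg_sub, ← hcs, ← Finset.sum_neg_distrib]
    simp only [neg_sub]
  have hU₀ : cent P m (fun s j => (s j).2.2.1) ≤ Real.log m₀ := by
    simpa using cent_le_log_card hP m fun s j => (s j).2.2.1
  have hV₀ : cent P m (fun s j => (s j).2.2.2) ≤ Real.log m₀ := by
    simpa using cent_le_log_card hP m fun s j => (s j).2.2.2
  have hX₁ : cent P (fun s j => (s j).1) (fun s => ((fun j => (s j).2.2.1), m s)) ≤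
      Real.log m₁ + (Real.log 2 + c.errorProb Q * (n * Real.log (Fintype.card 𝒳))) := by
    have f1 := cent_le_log_card_add hP (fun s j => (s j).1)
      (fun s => ((fun j => (s j).2.2.1), m s)) fun s => (c.enc (xBlock s, yBlock s)).2.1
    have f2 := cent_le_of_estimate hP (fun s j => (s j).1)
      (fun s => ((c.enc (xBlock s, yBlock s)).2.1, (fun j => (s j).2.2.1), m s))
      (fun b => c.decX (b.2.2, b.1, b.2.1)) (fun s => c.xHat s ≠ xBlock s)
      fun s hs => not_not.1 hs
    have f3 : (∑ s, if c.xHat s ≠ xBlock s then P s else 0) ≤ c.errorProb Q := by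
      refine le_trans (le_of_eq ?_) (le_max_left _ _)
      unfold blockProb
      refine Finset.sum_congr rfl fun s _ => ?_
      by_cases h : c.xHat s = xBlock s <;> simp [h, hPdef, blockLaw]
    have f4 : 0 ≤ (n : ℝ) * Real.log (Fintype.card 𝒳) :=
      mul_nonneg n.cast_nonneg (Real.log_natCast_nonneg _)
    have f5 : Real.log (Fintype.card (Fin n → 𝒳)) = n * Real.log (Fintype.card 𝒳) := by simp
    rw [f5] at f2
    rw [Fintype.card_fin] at f1
    linarith [mul_le_mul_of_nonneg_right f3 f4]
  have hY₁ : cent P (fun s j => (s j).2.1) (fun s => ((fun j => (s j).2.2.2), m s)) ≤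
      Real.log m₂ + (Real.log 2 + c.errorProb Q * (n * Real.log (Fintype.card 𝒴))) := by
    have f1 := cent_le_log_card_add hP (fun s j => (s j).2.1)
      (fun s => ((fun j => (s j).2.2.2), m s)) fun s => (c.enc (xBlock s, yBlock s)).2.2
    have f2 := cent_le_of_estimate hP (fun s j => (s j).2.1)
      (fun s => ((c.enc (xBlock s, yBlock s)).2.2, (fun j => (s j).2.2.2), m s))
      (fun b => c.decY (b.2.2, b.1, b.2.1)) (fun s => c.yHat s ≠ yBlock s)
      fun s hs => not_not.1 hs
    have f3 : (∑ s, if c.yHat s ≠ yBlock s then P s else 0) ≤ c.errorProb Q := by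
      refine le_trans (le_of_eq ?_) (le_max_right _ _)
      unfold blockProb
      refine Finset.sum_congr rfl fun s _ => ?_
      by_cases h : c.yHat s = yBlock s <;> simp [h, hPdef, blockLaw]
    have f4 : 0 ≤ (n : ℝ) * Real.log (Fintype.card 𝒴) :=
      mul_nonneg n.cast_nonneg (Real.log_natCast_nonneg _)
    have f5 : Real.log (Fintype.card (Fin n → 𝒴)) = n * Real.log (Fintype.card 𝒴) := by simp
    rw [f5] at f2
    rw [Fintype.card_fin] at f1
    linarith [mul_le_mul_of_nonneg_right f3 f4]
  have hxy : ∀ a b : 𝒳 × 𝒴 × 𝒰 × 𝒱, (a.1, a.2.1) = (b.1, b.2.1) ↔ a.1 = b.1 ∧ a.2.1 = b.2.1 :=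
    fun a b => Prod.mk.injEq .. ▸ Iff.rfl
  have hyx : ∀ a b : 𝒳 × 𝒴 × 𝒰 × 𝒱, (a.1, a.2.1) = (b.1, b.2.1) ↔ a.2.1 = b.2.1 ∧ a.1 = b.1 :=
    fun a b => (hxy a b).trans and_comm
  -- Csiszár's identity is trivial when the common rate is bounded through the receiver's own side
  -- information.
  have hself : ∀ f : Fin n → ℝ, ∀ x : ℝ, ∑ i, (f i - f i) = x - x := fun f x => by simp
  subst ha hhX hhY
  refine ⟨max_le ?_ ?_, ?_, ?_⟩
  · exact common_rate_bound hQ (fun z => (z.1, z.2.1)) (fun z => z.2.2.1) hm h1U hU₀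
  · exact common_rate_bound hQ (fun z => (z.1, z.2.1)) (fun z => z.2.2.2) hm h1V hV₀
  · rw [← max_add_add_right]
    exact max_le
      (sum_rate_bound hQ (fun z => (z.1, z.2.1)) (fun z => z.1) (fun z => z.2.1)
        (fun z => z.2.2.1) (fun z => z.2.2.1) hxy hm c.aux_congr h3U (hself _ _) hU₀ hX₁)
      (sum_rate_bound hQ (fun z => (z.1, z.2.1)) (fun z => z.1) (fun z => z.2.1)
        (fun z => z.2.2.1) (fun z => z.2.2.2) hxy hm c.aux_congr h3U hcs hV₀ hX₁)
  · rw [← max_add_add_right]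
    exact max_le
      (sum_rate_bound hQ (fun z => (z.1, z.2.1)) (fun z => z.2.1) (fun z => z.1)
        (fun z => z.2.2.2) (fun z => z.2.2.1) hyx hm c.aux_congr h3V hcs' hU₀ hY₁)
      (sum_rate_bound hQ (fun z => (z.1, z.2.1)) (fun z => z.2.1) (fun z => z.1)
        (fun z => z.2.2.2) (fun z => z.2.2.2) hyx hm c.aux_congr h3V (hself _ _) hV₀ hY₁)

end CodeConverse

/-! ### Time sharing -/

section TimeSharing

variable {S A B D W : Type*} [Fintype S] {n : ℕ}

/-- The laws of `(W, Z)` in which `Z` has law `Q` and `W` is the output of a channel whose input is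
`χ Z`. -/
def channelLaws (W : Type*) [Fintype W] (Q : S → ℝ) (χ : S → D) : Set (W × S → ℝ) :=
  {p | (∃ r : W → D → ℝ, (∀ w d, 0 ≤ r w d) ∧ ∀ w z, p (w, z) = r w (χ z) * Q z) ∧
    ∀ z, ∑ w, p (w, z) = Q z}

/-- The law of `((T, W_T), Z_T)` for an independent uniform time `T`. -/
noncomputable def timeSharedLaw (Q : S → ℝ) (w : Fin n → (Fin n → S) → W) :
    (Fin n × W) × S → ℝ :=
  law (fun x : Fin n × (Fin n → S) => (n : ℝ)⁻¹ * blockLaw (Fin n) Q x.2)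
    fun x => ((x.1, w x.1 x.2), x.2 x.1)

/-- The time is part of the condition, so the entropy splits over its values, each slice carrying
weight 1/n by homogeneity. -/
theorem cent_timeSharedLaw {Q : S → ℝ} (hQ : Q ∈ stdSimplex ℝ S) (w : Fin n → (Fin n → S) → W)
    [Fintype W] (f : S → A) (g : S → B) :
    cent (timeSharedLaw Q w) (fun x => f x.2) (fun x => (x.1, g x.2)) =
      (n : ℝ)⁻¹ * ∑ i, cent (blockLaw (Fin n) Q) (fun s => f (s i))
        (fun s => (w i s, g (s i))) := by
  have h := cent_prod (fun x : Fin n × (Fin n → S) => (n : ℝ)⁻¹ * blockLaw (Fin n) Q x.2)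
    (fun i s => f (s i)) fun i s => (w i s, g (s i))
  simp only [cent_smul _ _ _ _ (blockLaw_mem hQ).1, ← Finset.mul_sum] at h
  rw [← h, timeSharedLaw, cent_law]
  unfold cent
  congr 1 <;> exact ent_congr _ fun s t => by simp only [Prod.mk.injEq]; tauto

/-- Once letter `i` is overwritten by `z`, `w` depends only on the other positions and is
independent of the actual letter `i`. -/
theorem law_var_letter {Q : S → ℝ} (hQ : Q ∈ stdSimplex ℝ S) (i : Fin n) (w : (Fin n → S) → W)
    (a : W) (z : S) : law (blockLaw (Fin n) Q) (fun s => (w s, s i)) (a, z) =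
      law (blockLaw (Fin n) Q) (fun s => w (Function.update s i z)) a * Q z := by
  classical
  have hP := blockLaw_mem (ι := Fin n) hQ
  have h := law_prod_of_dependsOn Q {i} (f := fun s => s i)
    (g := fun s => w (Function.update s i z)) (fun s t h => h i rfl)
    (fun s t h => by
      refine congrArg w (funext fun j => ?_)
      rcases eq_or_ne j i with rfl | hj
      · rw [Function.update_self, Function.update_self]
      · rw [Function.update_of_ne hj, Function.update_of_ne hj, h j hj]) z a
  rw [hP.2, mul_one, law_eval hQ] at h
  rw [mul_comm, ← h]
  refine law_congr fun s _ => ?_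
  simp only [Prod.mk.injEq]
  constructor
  · rintro ⟨h1, rfl⟩
    simpa using h1
  · rintro ⟨rfl, h1⟩
    simpa using h1

theorem timeSharedLaw_mem {Q : S → ℝ} (hQ : Q ∈ stdSimplex ℝ S) (hn : n ≠ 0) (χ : S → D)
    {w : Fin n → (Fin n → S) → W} [Fintype W]
    (hw : ∀ i s t, χ (s i) = χ (t i) → (∀ j ≠ i, s j = t j) → w i s = w i t) :
    timeSharedLaw Q w ∈ channelLaws (Fin n × W) Q χ := by
  classical
  have hP := blockLaw_mem (ι := Fin n) hQ
  have hval : ∀ i a z, timeSharedLaw Q w ((i, a), z) =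
      (n : ℝ)⁻¹ * law (blockLaw (Fin n) Q) (fun s => (w i s, s i)) (a, z) := fun i a z => by
    simp only [timeSharedLaw, law, Fintype.sum_prod_type, Prod.mk.injEq, Finset.mul_sum]
    rw [Finset.sum_eq_single i]
    · simp
    · intro j _ hj
      simp [hj]
    · simp
  -- By `hw`, the overwriting letter matters only through its χ-value, so any preimage of `d`
  -- defines the channel. Values `d` outside the range of χ never enter the law.
  refine ⟨⟨fun x d => if h : ∃ z, χ z = d then (n : ℝ)⁻¹ * law (blockLaw (Fin n) Q)
    (fun s => w x.1 (Function.update s x.1 h.choose)) x.2 else 0, fun x d => ?_, ?_⟩, fun z => ?_⟩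
  · dsimp only
    split_ifs
    · exact mul_nonneg (by positivity) (law_nonneg hP.1 _ _)
    · exact le_rfl
  · rintro ⟨i, a⟩ z
    have hz : ∃ z', χ z' = χ z := ⟨z, rfl⟩
    rw [hval, law_var_letter hQ]
    dsimp only
    rw [dif_pos hz, mul_assoc]
    have hww : (fun s => w i (Function.update s i z)) =
        fun s => w i (Function.update s i hz.choose) := funext fun s =>
      hw i _ _ (by simpa using hz.choose_spec.symm) fun j hj => by simp [hj]
    rw [hww]
  · rw [Fintype.sum_prod_type]
    simp only [hval, ← Finset.mul_sum]
    have h1 : ∀ i : Fin n, ∑ a, law (blockLaw (Fin n) Q) (fun s => (w i s, s i)) (a, z) = Q z :=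
      fun i => by
        rw [← law_eval hQ i z]
        simp only [law]
        rw [Finset.sum_comm]
        refine Finset.sum_congr rfl fun s _ => ?_
        by_cases hs : s i = z <;> simp [hs]
    simp only [h1, Finset.sum_const, Finset.card_univ, Fintype.card_fin, nsmul_eq_mul]
    rw [← mul_assoc, inv_mul_cancel₀ (Nat.cast_ne_zero.2 hn), one_mul]

end TimeSharing

/-! ### Bounding the cardinality of the auxiliary alphabet -/

section Cardinality

variable {W ι D : Type*} [Fintype W] [Fintype ι]

/-- One step towards a vertex of a linear program: more support points than equality constraints
leave a direction in the kernel, along which one moves until a coordinate vanishes. -/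
theorem exists_smaller_support [DecidableEq W] (a : W → ι → ℝ) (b c : W → ℝ)
    (hb : ∀ w, 0 ≤ b w) (hc : ∀ w, 0 ≤ c w)
    (hcard : Fintype.card ι < (Finset.univ.filter fun w => c w ≠ 0).card) :
    ∃ c' : W → ℝ, (∀ w, 0 ≤ c' w) ∧ (∀ j, ∑ w, c' w * a w j = ∑ w, c w * a w j) ∧
      ∑ w, c' w * b w ≤ ∑ w, c w * b w ∧
      (Finset.univ.filter fun w => c' w ≠ 0) ⊂ Finset.univ.filter fun w => c w ≠ 0 := by
  obtain ⟨μ, hμ0, hμc, hμa⟩ : ∃ μ : W → ℝ, μ ≠ 0 ∧ (∀ w, c w = 0 → μ w = 0) ∧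
      ∀ j, ∑ w, μ w * a w j = 0 := by
    set T := Finset.univ.filter fun w => c w ≠ 0 with hT
    let L : (T → ℝ) →ₗ[ℝ] (ι → ℝ) := Fintype.linearCombination ℝ fun t : T => a t
    have hker : LinearMap.ker L ≠ ⊥ := LinearMap.ker_ne_bot_of_finrank_lt (by simpa using hcard)
    obtain ⟨x, hx, hx0⟩ := (Submodule.ne_bot_iff _).1 hker
    refine ⟨fun w => if h : w ∈ T then x ⟨w, h⟩ else 0, fun h0 => hx0 (funext fun t => ?_),
      fun w hw => dif_neg (by simp [hT, hw]), fun j => ?_⟩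
    · simpa using congrFun h0 t
    · have h1 := congrFun (LinearMap.mem_ker.1 hx) j
      simp only [L, Fintype.linearCombination_apply, Finset.sum_apply, Pi.smul_apply,
        smul_eq_mul, Pi.zero_apply] at h1
      refine Eq.trans ?_ h1
      dsimp only
      rw [← Finset.sum_subset (Finset.subset_univ T) fun w _ hw => by rw [dif_neg hw, zero_mul],
        ← Finset.sum_coe_sort T]
      simp
  -- Up to sign the direction does not raise the cost and has a negative entry; nonnegativity of `b`
  -- makes the two compatible.
  obtain ⟨μ, hμc, hμa, hμb, w₁, hw₁⟩ : ∃ μ : W → ℝ, (∀ w, c w = 0 → μ w = 0) ∧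
      (∀ j, ∑ w, μ w * a w j = 0) ∧ ∑ w, μ w * b w ≤ 0 ∧ ∃ w, μ w < 0 := by
    have hneg : ∀ ν : W → ℝ, (∑ w, (-ν) w * b w = -∑ w, ν w * b w) ∧
        ∀ j, ∑ w, (-ν) w * a w j = -∑ w, ν w * a w j := fun ν => by simp
    obtain ⟨w, hw⟩ := Function.ne_iff.1 hμ0
    by_cases hpos : ∀ w, 0 ≤ μ w
    · refine ⟨-μ, fun w h => by simp [hμc w h], fun j => by rw [(hneg μ).2, hμa, neg_zero], ?_,
        w, neg_neg_of_pos (lt_of_le_of_ne (hpos w) (Ne.symm hw))⟩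
      rw [(hneg μ).1]
      exact neg_nonpos.2 (Finset.sum_nonneg fun w _ => mul_nonneg (hpos w) (hb w))
    · push Not at hpos
      by_cases hs : ∑ w, μ w * b w ≤ 0
      · exact ⟨μ, hμc, hμa, hs, hpos⟩
      · refine ⟨-μ, fun w h => by simp [hμc w h], fun j => by rw [(hneg μ).2, hμa, neg_zero], ?_, ?_⟩
        · rw [(hneg μ).1]
          linarith
        · by_contra! h
          exact hs (Finset.sum_nonpos fun w _ => mul_nonpos_of_nonpos_of_nonneg
            (neg_nonneg.1 (h w)) (hb w))
  obtain ⟨w₀, hw₀, hmin⟩ := (Finset.univ.filter fun w => μ w < 0).exists_min_image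
    (fun w => c w / -μ w) ⟨w₁, by simp [hw₁]⟩
  simp only [Finset.mem_filter, Finset.mem_univ, true_and] at hw₀ hmin
  -- The largest step that keeps all weights nonnegative; it annihilates `w₀`.
  set t := c w₀ / -μ w₀ with ht
  have ht0 : 0 ≤ t := div_nonneg (hc _) (by linarith)
  have hsum : ∀ F : W → ℝ, ∑ w, (c w + t * μ w) * F w = ∑ w, c w * F w + t * ∑ w, μ w * F w :=
    fun F => by
      rw [Finset.mul_sum, ← Finset.sum_add_distrib]
      exact Finset.sum_congr rfl fun w _ => by ring
  refine ⟨fun w => c w + t * μ w, fun w => ?_, fun j => ?_, ?_, ?_⟩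
  · rcases lt_or_ge (μ w) 0 with h | h
    · have := hmin w h
      rw [le_div_iff₀ (by linarith)] at this
      linarith
    · exact add_nonneg (hc w) (mul_nonneg ht0 h)
  · rw [hsum fun w => a w j, hμa, mul_zero, add_zero]
  · rw [hsum b]
    linarith [mul_nonpos_of_nonneg_of_nonpos ht0 hμb]
  · refine (Finset.ssubset_iff_of_subset fun w hw => ?_).2 ⟨w₀, ?_, ?_⟩
    · simp only [Finset.mem_filter, Finset.mem_univ, true_and] at hw ⊢
      exact fun h => hw (by rw [h, hμc w h]; ring)
    · simp only [Finset.mem_filter, Finset.mem_univ, true_and]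
      exact fun h => hw₀.ne (hμc w₀ h)
    · simp only [Finset.mem_filter, Finset.mem_univ, true_and, not_not, ht]
      have := hw₀.ne
      field_simp
      ring

/-- A basic feasible solution that is no more expensive than a given feasible point. -/
theorem exists_small_support [DecidableEq W] (a : W → ι → ℝ) (b c : W → ℝ)
    (hb : ∀ w, 0 ≤ b w) (hc : ∀ w, 0 ≤ c w) :
    ∃ c' : W → ℝ, (∀ w, 0 ≤ c' w) ∧ (∀ j, ∑ w, c' w * a w j = ∑ w, c w * a w j) ∧
      ∑ w, c' w * b w ≤ ∑ w, c w * b w ∧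
      (Finset.univ.filter fun w => c' w ≠ 0).card ≤ Fintype.card ι := by
  induction hk : (Finset.univ.filter fun w => c w ≠ 0).card using Nat.strong_induction_on
    generalizing c with
  | _ k ih =>
    by_cases h : Fintype.card ι < k
    · obtain ⟨c₁, h0, h1, h2, h3⟩ := exists_smaller_support a b c hb hc (hk ▸ h)
      obtain ⟨c₂, k0, k1, k2, k3⟩ := ih _ (hk ▸ Finset.card_lt_card h3) c₁ h0 rfl
      exact ⟨c₂, k0, fun j => (k1 j).trans (h1 j), k2.trans h2, k3⟩
    · exact ⟨c, hc, fun _ => rfl, le_rfl, by omega⟩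

/-- Reduction of the output alphabet of a channel, with `card ι` homogeneous functionals preserved
and one more not increased. -/
theorem exists_channel_fin [Fintype D] (r : W → D → ℝ) (hr : ∀ w d, 0 ≤ r w d)
    (H : ι → (D → ℝ) → ℝ) (H' : (D → ℝ) → ℝ)
    (hH : ∀ j c ρ, (∀ d, 0 ≤ ρ d) → H j (fun d => c * ρ d) = c * H j ρ)
    (hH' : ∀ c ρ, (∀ d, 0 ≤ ρ d) → H' (fun d => c * ρ d) = c * H' ρ)
    (hpos : ∀ ρ, (∀ d, 0 ≤ ρ d) → 0 ≤ H' ρ) {K : ℕ} (hK : Fintype.card D + Fintype.card ι ≤ K) :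
    ∃ r' : Fin K → D → ℝ, (∀ k d, 0 ≤ r' k d) ∧
      (∀ d, ∑ k, r' k d = ∑ w, r w d) ∧ (∀ j, ∑ k, H j (r' k) = ∑ w, H j (r w)) ∧
      ∑ k, H' (r' k) ≤ ∑ w, H' (r w) := by
  classical
  -- The rows of the channel are reweighted, starting from weight 1. The constraints are the `card
  -- D` column sums and the functionals `H`; `H'` is the cost and so adds nothing to the count.
  obtain ⟨c, hc, hca, hcb, hcard⟩ := exists_small_support
    (fun w => Sum.elim (r w) fun j => H j (r w)) (fun w => H' (r w)) (fun _ => 1)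
    (fun w => hpos _ (hr w)) fun _ => zero_le_one
  set T := Finset.univ.filter fun w => c w ≠ 0 with hT
  obtain ⟨e⟩ : Nonempty (T ↪ Fin K) := by
    refine Function.Embedding.nonempty_of_card_le ?_
    rw [Fintype.card_coe, Fintype.card_fin]
    rw [Fintype.card_sum] at hcard
    exact hcard.trans hK
  set r' : Fin K → D → ℝ :=
    Function.extend e (fun t d => c t * r t d) 0 with hr'
  have hsum : ∀ G : (D → ℝ) → ℝ, (∀ c ρ, (∀ d, 0 ≤ ρ d) → G (fun d => c * ρ d) = c * G ρ) →
      ∑ k, G (r' k) = ∑ w, c w * G (r w) := fun G hG => by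
    have hG0 : G 0 = 0 := by
      have := hG 0 0 fun _ => le_rfl
      simp only [zero_mul] at this
      exact this
    rw [← Fintype.sum_of_injective e e.injective (fun t : T => c t * G (r t)) _
      (fun k hk => ?_) fun t => ?_]
    · rw [Finset.sum_coe_sort T fun w => c w * G (r w)]
      exact Finset.sum_subset (Finset.subset_univ _) fun w _ hw => by
        have : c w = 0 := by simpa [hT] using hw
        simp [this]
    · rw [hr', Function.extend_apply' _ _ _ fun ⟨t, ht⟩ => hk ⟨t, ht⟩]
      exact hG0
    · rw [hr', e.injective.extend_apply, hG _ _ (hr t)]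
  refine ⟨r', fun k d => ?_, fun d => ?_, fun j => ?_, ?_⟩
  · by_cases hk : ∃ t, e t = k
    · obtain ⟨t, rfl⟩ := hk
      rw [hr', e.injective.extend_apply]
      exact mul_nonneg (hc _) (hr _ _)
    · rw [hr', Function.extend_apply' _ _ _ hk]
      exact le_rfl
  · rw [hsum (fun ρ => ρ d) fun _ _ _ => rfl]
    simpa using hca (Sum.inl d)
  · rw [hsum (H j) (hH j)]
    simpa using hca (Sum.inr j)
  · rw [hsum H' hH']
    simpa using hcb

variable {S : Type*} [Fintype S] {A₁ A₂ A₃ A₄ B₁ B₂ B₃ B₄ : Type*}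

/-- Reduction of the auxiliary alphabet, with three conditional entropies preserved and one more not
increased. -/
theorem exists_mem_channelLaws_fin [Fintype D] {Q : S → ℝ} (hQ : ∀ z, 0 ≤ Q z) {χ : S → D}
    {p : W × S → ℝ} (hp : p ∈ channelLaws W Q χ) (f₁ : S → A₁) (g₁ : S → B₁) (f₂ : S → A₂)
    (g₂ : S → B₂) (f₃ : S → A₃) (g₃ : S → B₃) (f₄ : S → A₄) (g₄ : S → B₄) {K : ℕ}
    (hK : Fintype.card D + 3 ≤ K) :
    ∃ p' ∈ channelLaws (Fin K) Q χ,
      cent p' (fun x => f₁ x.2) (fun x => (x.1, g₁ x.2)) =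
        cent p (fun x => f₁ x.2) (fun x => (x.1, g₁ x.2)) ∧
      cent p' (fun x => f₂ x.2) (fun x => (x.1, g₂ x.2)) =
        cent p (fun x => f₂ x.2) (fun x => (x.1, g₂ x.2)) ∧
      cent p' (fun x => f₃ x.2) (fun x => (x.1, g₃ x.2)) =
        cent p (fun x => f₃ x.2) (fun x => (x.1, g₃ x.2)) ∧
      cent p' (fun x => f₄ x.2) (fun x => (x.1, g₄ x.2)) ≤
        cent p (fun x => f₄ x.2) (fun x => (x.1, g₄ x.2)) := by
  obtain ⟨⟨r, hr, hpr⟩, hsum⟩ := hp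
  have hnn : ∀ ρ : D → ℝ, (∀ d, 0 ≤ ρ d) → ∀ z, 0 ≤ ρ (χ z) * Q z := fun ρ hρ z =>
    mul_nonneg (hρ _) (hQ z)
  -- Each conditional entropy given W is a sum over the rows of a homogeneous functional of the
  -- unnormalised row. Preserving the column sums preserves the marginal `Q`.
  obtain ⟨r', hr', h1, h2, h3⟩ := exists_channel_fin r hr
    ![fun ρ => cent (fun z => ρ (χ z) * Q z) f₁ g₁, fun ρ => cent (fun z => ρ (χ z) * Q z) f₂ g₂,
      fun ρ => cent (fun z => ρ (χ z) * Q z) f₃ g₃]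
    (fun ρ => cent (fun z => ρ (χ z) * Q z) f₄ g₄)
    (fun j c ρ hρ => by
      fin_cases j <;>
      · change cent (fun z => c * ρ (χ z) * Q z) _ _ = c * cent (fun z => ρ (χ z) * Q z) _ _
        simp only [mul_assoc]
        exact cent_smul c _ _ _ (hnn ρ hρ))
    (fun c ρ hρ => by
      simp only [mul_assoc]
      exact cent_smul c _ _ _ (hnn ρ hρ))
    (fun ρ hρ => cent_nonneg (hnn ρ hρ) _ _) (K := K) (by simpa using hK)
  refine ⟨fun x => r' x.1 (χ x.2) * Q x.2, ⟨⟨r', hr', fun _ _ => rfl⟩, fun z => ?_⟩, ?_⟩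
  · rw [← hsum z]
    simp only [hpr, ← Finset.sum_mul, h1]
  · simp only [cent_prod _ (fun _ => f₁) fun _ => g₁, cent_prod _ (fun _ => f₂) fun _ => g₂,
      cent_prod _ (fun _ => f₃) fun _ => g₃, cent_prod _ (fun _ => f₄) fun _ => g₄, hpr]
    exact ⟨h2 0, h2 1, h2 2, h3⟩

end Cardinality

/-! ### The outer bound -/

section OuterBound

/-- Through `Real.negMulLog` continuity also holds at laws with vanishing probabilities. -/
theorem continuous_cent {Ω A B : Type*} [Fintype Ω] [Fintype A] [Fintype B] (f : Ω → A)
    (g : Ω → B) : Continuous fun p : Ω → ℝ => cent p f g := by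
  classical
  simp only [cent, ent_eq_sum_negMulLog, law]
  refine Continuous.sub ?_ ?_ <;>
  · refine continuous_finsetSum _ fun a _ => Real.continuous_negMulLog.comp ?_
    refine continuous_finsetSum _ fun ω _ => ?_
    split_ifs <;> fun_prop

variable {𝒲 𝒳 𝒴 𝒰 𝒱 : Type*} [Fintype 𝒲] [Fintype 𝒳] [Fintype 𝒴] [Fintype 𝒰] [Fintype 𝒱]
  {Q : 𝒳 × 𝒴 × 𝒰 × 𝒱 → ℝ}

/-- The division-free Markov condition is a polynomial identity, hence closed. -/
theorem isCompact_auxiliaryLaws : IsCompact (auxiliaryLaws 𝒲 Q) := by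
  have h₁ : IsClosed {p : 𝒲 × 𝒳 × 𝒴 × 𝒰 × 𝒱 → ℝ |
      ∀ x y u v, ∑ w, p (w, x, y, u, v) = Q (x, y, u, v)} := by
    simp only [Set.ofPred_forall]
    exact isClosed_iInter fun x => isClosed_iInter fun y => isClosed_iInter fun u =>
      isClosed_iInter fun v => isClosed_eq (by fun_prop) (by fun_prop)
  have h₂ : IsClosed {p : 𝒲 × 𝒳 × 𝒴 × 𝒰 × 𝒱 → ℝ | ∀ w x y u v,
      p (w, x, y, u, v) * (∑ w', ∑ u', ∑ v', p (w', x, y, u', v')) =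
        (∑ u', ∑ v', p (w, x, y, u', v')) * ∑ w', p (w', x, y, u, v)} := by
    simp only [Set.ofPred_forall]
    exact isClosed_iInter fun w => isClosed_iInter fun x => isClosed_iInter fun y =>
      isClosed_iInter fun u => isClosed_iInter fun v => isClosed_eq (by fun_prop) (by fun_prop)
  exact (isCompact_stdSimplex ℝ _).inter_right (h₁.inter h₂)

theorem channelLaws_subset_auxiliaryLaws (hQ : Q ∈ stdSimplex ℝ (𝒳 × 𝒴 × 𝒰 × 𝒱)) :
    channelLaws 𝒲 Q (fun z => (z.1, z.2.1)) ⊆ auxiliaryLaws 𝒲 Q := by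
  rintro p ⟨⟨r, hr, hpr⟩, hsum⟩
  refine ⟨⟨fun x => ?_, ?_⟩, fun x y u v => hsum _, fun w x y u v => ?_⟩
  · rw [← Prod.mk.eta (p := x), hpr]
    exact mul_nonneg (hr _ _) (hQ.1 _)
  · rw [Fintype.sum_prod_type, Finset.sum_comm]
    simp only [hsum, hQ.2]
  · simp only [hpr, ← Finset.mul_sum, ← Finset.sum_mul]
    ring

/-- `max {I(X, Y; W | U), I(X, Y; W | V)}` in nats, for a law with `(X, Y, U, V)`-marginal `Q`. -/
noncomputable def commonInfoNats (Q : 𝒳 × 𝒴 × 𝒰 × 𝒱 → ℝ) (p : 𝒲 × 𝒳 × 𝒴 × 𝒰 × 𝒱 → ℝ) : ℝ :=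
  max
    (cent Q (fun z => (z.1, z.2.1)) (fun z => z.2.2.1) -
      cent p (fun x => (x.2.1, x.2.2.1)) (fun x => (x.1, x.2.2.2.1)))
    (cent Q (fun z => (z.1, z.2.1)) (fun z => z.2.2.2) -
      cent p (fun x => (x.2.1, x.2.2.1)) (fun x => (x.1, x.2.2.2.2)))

/-- The largest violation, in nats, of the three inequalities of the outer bound. -/
noncomputable def violation (Q : 𝒳 × 𝒴 × 𝒰 × 𝒱 → ℝ) (R₀ R₁ R₂ : ℝ)
    (p : 𝒲 × 𝒳 × 𝒴 × 𝒰 × 𝒱 → ℝ) : ℝ :=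
  max (commonInfoNats Q p - R₀ * Real.log 2)
    (max
      (commonInfoNats Q p + cent p (fun x => x.2.1) (fun x => (x.1, x.2.2.2.1)) -
        (R₀ + R₁) * Real.log 2)
      (commonInfoNats Q p + cent p (fun x => x.2.2.1) (fun x => (x.1, x.2.2.2.2)) -
        (R₀ + R₂) * Real.log 2))

theorem continuous_violation (R₀ R₁ R₂ : ℝ) :
    Continuous (violation (𝒲 := 𝒲) Q R₀ R₁ R₂) := by
  have hc : Continuous (commonInfoNats (𝒲 := 𝒲) Q) :=
    (continuous_const.sub (continuous_cent _ _)).max (continuous_const.sub (continuous_cent _ _))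
  exact (hc.sub continuous_const).max (((hc.add (continuous_cent _ _)).sub continuous_const).max
    ((hc.add (continuous_cent _ _)).sub continuous_const))

theorem mem_outerRegion_of_violation {p : 𝒲 × 𝒳 × 𝒴 × 𝒰 × 𝒱 → ℝ} (hp : p ∈ auxiliaryLaws 𝒲 Q)
    {R₀ R₁ R₂ : ℝ} (h : violation Q R₀ R₁ R₂ p ≤ 0) : (R₀, R₁, R₂) ∈ outerRegion p := by
  classical
  have h0 := hp.1.1
  have hQ : law p Prod.snd = Q := by
    ext ⟨x, y, u, v⟩
    rw [← hp.2.1]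
    simp only [law]
    rw [Fintype.sum_prod_type]
    refine Finset.sum_congr rfl fun w _ => ?_
    rw [Finset.sum_eq_single (x, y, u, v)]
    · simp
    · exact fun z _ hz => if_neg hz
    · simp
  have hlog : 0 < Real.log 2 := Real.log_pos (by norm_num)
  have hU : cent p (fun ω => (rvX ω, rvY ω)) rvU =
      cent Q (fun z => (z.1, z.2.1)) (fun z => z.2.2.1) := by
    rw [← hQ, cent_law]
    rfl
  have hV : cent p (fun ω => (rvX ω, rvY ω)) rvV =
      cent Q (fun z => (z.1, z.2.1)) (fun z => z.2.2.2) := by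
    rw [← hQ, cent_law]
    rfl
  have hc : commonInfo p = commonInfoNats Q p / Real.log 2 := by
    unfold commonInfo condMutualInfo commonInfoNats
    simp only [condEntropy_eq_cent h0, hU, hV, ← sub_div]
    exact (max_div_div_right hlog.le _ _)
  simp only [violation, max_le_iff, sub_nonpos] at h
  refine ⟨?_, ?_, ?_⟩
  · rw [hc, div_le_iff₀ hlog]
    exact h.1
  · rw [hc, condEntropy_eq_cent h0, ← add_div, div_le_iff₀ hlog]
    exact h.2.1
  · rw [hc, condEntropy_eq_cent h0, ← add_div, div_le_iff₀ hlog]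
    exact h.2.2

/-- A code yields an auxiliary variable that violates the outer bound for its rates by little. -/
theorem Code.exists_violation_le {n m₀ m₁ m₂ : ℕ} (c : Code 𝒳 𝒴 𝒰 𝒱 n m₀ m₁ m₂) (hn : n ≠ 0)
    (hQ : Q ∈ stdSimplex ℝ (𝒳 × 𝒴 × 𝒰 × 𝒱)) {R₀ R₁ R₂ ε : ℝ} (hε : 0 ≤ ε)
    (hnε : (n : ℝ)⁻¹ ≤ ε) (he : c.errorProb Q ≤ ε)
    (h₀ : 1 / (n : ℝ) * Real.logb 2 (m₀ : ℝ) ≤ R₀ + ε)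
    (h₁ : 1 / (n : ℝ) * Real.logb 2 (m₁ : ℝ) ≤ R₁ + ε)
    (h₂ : 1 / (n : ℝ) * Real.logb 2 (m₂ : ℝ) ≤ R₂ + ε) :
    ∃ p ∈ auxiliaryLaws (Fin (Fintype.card 𝒳 * Fintype.card 𝒴 + 3)) Q,
      violation Q R₀ R₁ R₂ p ≤ ε * (3 * Real.log 2 + Real.log (Fintype.card 𝒳) +
        Real.log (Fintype.card 𝒴)) := by
  have hlog : 0 < Real.log 2 := Real.log_pos (by norm_num)
  have hn0 : (n : ℝ) ≠ 0 := Nat.cast_ne_zero.2 hn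
  have hni : (0 : ℝ) ≤ (n : ℝ)⁻¹ := by positivity
  set N : ℝ := (n : ℝ)⁻¹ with hN
  have hrate : ∀ (m : ℕ) (R : ℝ), 1 / (n : ℝ) * Real.logb 2 (m : ℝ) ≤ R + ε →
      N * Real.log m ≤ (R + ε) * Real.log 2 := fun m R h => by
    rw [← div_le_iff₀ hlog]
    calc N * Real.log m / Real.log 2 = 1 / (n : ℝ) * Real.logb 2 (m : ℝ) := by
          rw [hN, Real.logb, one_div, mul_div_assoc]
      _ ≤ _ := h
  replace h₀ := hrate _ _ h₀
  replace h₁ := hrate _ _ h₁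
  replace h₂ := hrate _ _ h₂
  set q := timeSharedLaw Q c.aux with hq
  have hqmem := timeSharedLaw_mem hQ hn (fun z => (z.1, z.2.1)) c.aux_congr
  obtain ⟨p, hp, hU, hV, hX, hY⟩ := exists_mem_channelLaws_fin hQ.1 hqmem
    (fun z => (z.1, z.2.1)) (fun z => z.2.2.1) (fun z => (z.1, z.2.1)) (fun z => z.2.2.2)
    (fun z => z.1) (fun z => z.2.2.1) (fun z => z.2.1) (fun z => z.2.2.2)
    (K := Fintype.card 𝒳 * Fintype.card 𝒴 + 3) (by rw [Fintype.card_prod])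
  rw [cent_timeSharedLaw hQ c.aux (fun z => (z.1, z.2.1)) fun z => z.2.2.1] at hU
  rw [cent_timeSharedLaw hQ c.aux (fun z => (z.1, z.2.1)) fun z => z.2.2.2] at hV
  rw [cent_timeSharedLaw hQ c.aux (fun z => z.1) fun z => z.2.2.1] at hX
  rw [cent_timeSharedLaw hQ c.aux (fun z => z.2.1) fun z => z.2.2.2] at hY
  refine ⟨p, channelLaws_subset_auxiliaryLaws hQ hp, ?_⟩
  obtain ⟨k0, k1, k2⟩ := c.converse hQ rfl rfl rfl
  set SU := ∑ i, cent (blockLaw (Fin n) Q) (fun s => ((s i).1, (s i).2.1))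
    (fun s => (c.aux i s, (s i).2.2.1))
  set SV := ∑ i, cent (blockLaw (Fin n) Q) (fun s => ((s i).1, (s i).2.1))
    (fun s => (c.aux i s, (s i).2.2.2))
  set SX := ∑ i, cent (blockLaw (Fin n) Q) (fun s => (s i).1) (fun s => (c.aux i s, (s i).2.2.1))
  set SY := ∑ i, cent (blockLaw (Fin n) Q) (fun s => (s i).2.1) (fun s => (c.aux i s, (s i).2.2.2))
  set CU := cent Q (fun z => (z.1, z.2.1)) (fun z => z.2.2.1)
  set CV := cent Q (fun z => (z.1, z.2.1)) (fun z => z.2.2.2)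
  have hNn : N * n = 1 := inv_mul_cancel₀ hn0
  have hc : commonInfoNats Q p = N * max (n * CU - SU) (n * CV - SV) := by
    rw [mul_max_of_nonneg _ _ hni, mul_sub, mul_sub, ← mul_assoc, ← mul_assoc, hNn, one_mul,
      one_mul, ← hU, ← hV]
    rfl
  have hlX : 0 ≤ Real.log (Fintype.card 𝒳) := Real.log_natCast_nonneg _
  have hlY : 0 ≤ Real.log (Fintype.card 𝒴) := Real.log_natCast_nonneg _
  -- The Fano remainder per letter: 1/n ≤ ε controls the log 2, the error probability controls the
  -- rest.
  have hrem : ∀ l : ℝ, 0 ≤ l → N * (Real.log 2 + c.errorProb Q * (n * l)) ≤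
      ε * (Real.log 2 + l) := fun l hl => by
    have e : N * (Real.log 2 + c.errorProb Q * (n * l)) =
        N * Real.log 2 + (N * n) * (c.errorProb Q * l) := by ring
    rw [e, hNn, one_mul, mul_add]
    exact add_le_add (mul_le_mul_of_nonneg_right hnε hlog.le) (mul_le_mul_of_nonneg_right he hl)
  have hrX := hrem _ hlX
  have hrY := hrem _ hlY
  replace k0 := mul_le_mul_of_nonneg_left k0 hni
  replace k1 := mul_le_mul_of_nonneg_left k1 hni
  replace k2 := mul_le_mul_of_nonneg_left k2 hni
  simp only [mul_add N, ← hc] at k0 k1 k2 hrX hrY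
  have p1 := mul_nonneg hε hlX
  have p2 := mul_nonneg hε hlY
  have p3 := mul_nonneg hε hlog.le
  -- A sum-rate inequality loses ε log 2 for each of its two rates and once more in Fano, whence the
  -- factor 3.
  refine max_le ?_ (max_le ?_ ?_)
  · linarith
  · have : cent p (fun x => x.2.1) (fun x => (x.1, x.2.2.2.1)) = N * SX := hX
    rw [this]
    linarith
  · have : cent p (fun x => x.2.2.1) (fun x => (x.1, x.2.2.2.2)) ≤ N * SY := hY
    linarith

end OuterBound

end GrayWyner

theorem theorem1 {𝒳 𝒴 𝒰 𝒱 : Type*} [Fintype 𝒳] [Fintype 𝒴] [Fintype 𝒰] [Fintype 𝒱]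
    (Q : 𝒳 × 𝒴 × 𝒰 × 𝒱 → ℝ) (hQ : Q ∈ stdSimplex ℝ (𝒳 × 𝒴 × 𝒰 × 𝒱))
    (R₀ R₁ R₂ : ℝ) (hR : GrayWyner.Achievable Q R₀ R₁ R₂) :
    ∃ k : ℕ, k ≤ Fintype.card 𝒳 * Fintype.card 𝒴 + 3 ∧
      ∃ p ∈ GrayWyner.auxiliaryLaws (Fin k) Q, (R₀, R₁, R₂) ∈ GrayWyner.outerRegion p := by
  refine ⟨_, le_rfl, ?_⟩
  set L := 3 * Real.log 2 + Real.log (Fintype.card 𝒳) + Real.log (Fintype.card 𝒴)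
  have hL : 0 < L := by
    have h1 : 0 < Real.log 2 := Real.log_pos (by norm_num)
    have h2 : 0 ≤ Real.log (Fintype.card 𝒳) := Real.log_natCast_nonneg _
    have h3 : 0 ≤ Real.log (Fintype.card 𝒴) := Real.log_natCast_nonneg _
    positivity
  have key : ∀ ε : ℝ, 0 < ε → ∃ p ∈ GrayWyner.auxiliaryLaws
      (Fin (Fintype.card 𝒳 * Fintype.card 𝒴 + 3)) Q,
      GrayWyner.violation Q R₀ R₁ R₂ p ≤ ε * L := fun ε hε => by
    obtain ⟨n₀, hn₀⟩ := hR ε hε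
    -- The block length must also satisfy 1/n ≤ ε, and the `+ 1` below keeps it nonzero.
    obtain ⟨n₁, hn₁⟩ := exists_nat_ge ε⁻¹
    have hpos : 0 < max n₀ (n₁ + 1) := by omega
    obtain ⟨m₀, m₁, m₂, c, he, h0, h1, h2⟩ := hn₀ _ (le_max_left n₀ (n₁ + 1))
    refine c.exists_violation_le hpos.ne' hQ hε.le ?_ he h0 h1 h2
    refine inv_le_of_inv_le₀ hε (hn₁.trans ?_)
    exact_mod_cast (Nat.le_succ n₁).trans (le_max_right n₀ (n₁ + 1))
  -- Only used to know that the compact set is nonempty.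
  obtain ⟨p₁, hp₁, -⟩ := key 1 one_pos
  obtain ⟨p, hp, hmin⟩ := GrayWyner.isCompact_auxiliaryLaws.exists_isMinOn ⟨p₁, hp₁⟩
    (GrayWyner.continuous_violation (Q := Q) R₀ R₁ R₂).continuousOn
  refine ⟨p, hp, GrayWyner.mem_outerRegion_of_violation hp (le_of_forall_pos_le_add fun δ hδ => ?_)⟩
  obtain ⟨p', hp', h⟩ := key (δ / L) (div_pos hδ hL)
  rw [div_mul_cancel₀ _ hL.ne'] at h
  rw [zero_add]
  exact (hmin hp').trans h
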